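/- **Computational adequacy of Proto-Quipper-C.** Let $\mathcal M$ be a strict symmetric premonoidal category (tensor $\otimes$, unit $I$, actions $X\rtimes f$ and $f\ltimes X$, no interchange law, central symmetries) and let every wire type $w$ be assigned an object $\llbracket w\rrbracket$ of $\mathcal M$. A label context $Q=\ell_1:w_1,\dots,\ell_n:w_n$ (distinct labels) denotes $\llbracket w_1\rrbracket\otimes\dots\otimes\llbracket w_n\rrbracket$, and a labelled circuit $C:Q\to L$ is a morphism $\llbracket Q\rrbracket\to\llbracket L\rrbracket$ of $\mathcal M$. *Language.* Bundle types are $T,U::=\mathbb 1\mid w\mid T\otimes U$; parameter types are $P,R::=\mathbb 1\mid\mathsf{Nat}\mid P\otimes R\mid{!A}\mid\mathrm{Circ}(T,U)$; types are $A,B::=P\mid T\mid A\otimes B\mid A\multimap_T B$, where the closure annotation $T$ (the type of the captured wires) is taken up to the associativity and unit laws of $\otimes$. Values are $V,W::=*\mid n\mid x\mid\ell\mid\lambda x_A.M\mid\mathsf{lift}\,M\mid(\vec\ell,C,\vec k)\mid\langle V,W\rangle$, where $(\vec\ell,C,\vec k)$ is a boxed circuit with interfaces the wire bundles $\vec\ell,\vec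 k$. Computations are $M,N::=V\,W\mid\mathsf{force}\,V\mid\mathsf{box}_T V\mid\mathsf{apply}(V,W)\mid\mathsf{let}\,\langle x,y\rangle=V\,\mathsf{in}\,M\mid\mathsf{ifz}\,V\,M\,N\mid\mathsf{return}\,V\mid\mathsf{let}\,x=M\,\mathsf{in}\,N$. The judgments $\Gamma\vdash V:A$ and $\Gamma\vdash M:A$ are those of a linear call-by-value type system with ordered contexts of variables and labels, in which only contexts $\Phi$ of variables of parameter type may be duplicated or discarded, exchange is a rule for computations, and $\lambda x_A.M$ has type $A\multimap_{\sharp\Gamma}B$ in context $\Gamma$ when $\Gamma,x:A\vdash M:B$. The big-step relation $(C,M)\Downarrow(D,V)$ evaluates $M$ while extending the circuit $C$: $\mathsf{apply}$ appends a relabelled copy of a boxed circuit to the current one, and $\mathsf{box}_T V$ evaluates $V\,\vec\ell$ on fresh labels $\vec\ell:T$, starting from the identity circuit, and returns the resulting boxed circuit; the other rules are the usual ones. Write $Q\vdash(C,M):A;Q'$ if $C$ is a circuit from $Q$ to (a permutation of) $L,Q'$ for some label context $L$ disjoint from $Q'$ with $L\vdash M:A$, and similarly for $(C,V)$ with $V$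 a value. *Semantics.* Every type $A$ denotes a pair $(\flat\llbracket A\rrbracket,\sharp\llbracket A\rrbracket)$ of a set and an object of $\mathcal M$, with $$\flat\llbracket\mathrm{Circ}(T,U)\rrbracket=\mathcal M(\llbracket T\rrbracket,\llbracket U\rrbracket),\qquad \flat\llbracket A\multimap_T B\rrbracket=\flat\llbracket A\rrbracket\to\flat\llbracket B\rrbracket\times\mathcal M(\llbracket T\rrbracket\otimes\sharp\llbracket A\rrbracket,\sharp\llbracket B\rrbracket),\qquad \sharp\llbracket A\multimap_T B\rrbracket=\llbracket T\rrbracket,$$ $\sharp$ being $I$ on parameter types, $\llbracket w\rrbracket$ on wires, and multiplicative on $\otimes$. Let $\mathcal T(S,U,X)=X\times\mathcal M(S,U)$ be the circuit indexed monad, $\mathbf{Set}_{\mathcal T}$ its Kleisli category, whose morphisms $(X,S)\to(Y,U)$ are the functions $X\to Y\times\mathcal M(S,U)$, and $J:\mathbf{Set}\times\mathcal M\to\mathbf{Set}_{\mathcal T}$, $J(f,c)(x)=(f(x),c)$. A derivation of $\Gamma\vdash V:A$ denotes a function $\flat\llbracket\Gamma\rrbracket\to\flat\llbracket A\rrbracket$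 together with the identity of $\sharp\llbracket\Gamma\rrbracket=\sharp\llbracket A\rrbracket$. A derivation of $\Gamma\vdash M:A$ denotes a morphism of $\mathbf{Set}_{\mathcal T}$ from $\llbracket\Gamma\rrbracket$ to $\llbracket A\rrbracket$. Finally, writing $\mathbf{perm}$ for the permutation isomorphism from the codomain of $C$ to $\llbracket L,Q'\rrbracket$ and $;$ for composition in diagrammatic order, $\llbracket(C,M)\rrbracket=J(\mathrm{id}_1,C;\mathbf{perm});(\llbracket M\rrbracket\ltimes\llbracket Q'\rrbracket)$ in $\mathbf{Set}_{\mathcal T}$ and $\llbracket(D,V)\rrbracket=(\mathrm{id}_1,D;\mathbf{perm});(\llbracket V\rrbracket\ltimes\llbracket Q'\rrbracket)$ in $\mathbf{Set}\times\mathcal M$. **Theorem.** Suppose that $\emptyset\vdash(C,M):\mathbb 1;\emptyset$ and $\emptyset\vdash(D,V):\mathbb 1;\emptyset$, where $V$ is a value, and that $\llbracket(C,M)\rrbracket=J(\llbracket(D,V)\rrbracket)$ (for any choice of typing derivations). Then $(C,M)\Downarrow(D,V)$. (No renaming of labels is needed here, since the interfaces of $D$ are empty and $V$ has type $\mathbb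 1$.) -/

import Mathlib

open CategoryTheory

universe v u w

/-!
Syntax, type system, operational semantics and denotational semantics of Proto-Quipper-C,
over an arbitrary strict symmetric premonoidal category of circuits.
-/

namespace PQC

/-! ### Circuits: strict symmetric premonoidal categories -/

/-- A strict symmetric premonoidal category.  The objects form a monoid `(𝓜, *, 1)` (tensor and
unit).  `wL X f` is `X ⋊ f` and `wR f X` is `f ⋉ X`.  Interchange is *not* assumed; only the
symmetry is required to be central.  Strictness is expressed by heterogeneous equality, that is
equality on the nose. -/
class StrictSymmPremonoidal (𝓜 : Type u) extends Category.{v} 𝓜, Monoid 𝓜 where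
  wL : ∀ (X : 𝓜) {Y Z : 𝓜}, (Y ⟶ Z) → (X * Y ⟶ X * Z)
  wR : ∀ {Y Z : 𝓜}, (Y ⟶ Z) → ∀ X : 𝓜, (Y * X ⟶ Z * X)
  wL_id : ∀ X Y : 𝓜, wL X (𝟙 Y) = 𝟙 (X * Y)
  wR_id : ∀ X Y : 𝓜, wR (𝟙 Y) X = 𝟙 (Y * X)
  wL_comp : ∀ (X : 𝓜) {Y Z U : 𝓜} (f : Y ⟶ Z) (g : Z ⟶ U), wL X (f ≫ g) = wL X f ≫ wL X g
  wR_comp : ∀ {Y Z U : 𝓜} (f : Y ⟶ Z) (g : Z ⟶ U) (X : 𝓜), wR (f ≫ g) X = wR f X ≫ wR g X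
  wL_unit : ∀ {Y Z : 𝓜} (f : Y ⟶ Z), HEq (wL 1 f) f
  wR_unit : ∀ {Y Z : 𝓜} (f : Y ⟶ Z), HEq (wR f 1) f
  wL_tensor : ∀ (X X' : 𝓜) {Y Z : 𝓜} (f : Y ⟶ Z), HEq (wL (X * X') f) (wL X (wL X' f))
  wR_tensor : ∀ {Y Z : 𝓜} (f : Y ⟶ Z) (X X' : 𝓜), HEq (wR f (X * X')) (wR (wR f X) X')
  wL_wR : ∀ (X : 𝓜) {Y Z : 𝓜} (f : Y ⟶ Z) (X' : 𝓜), HEq (wL X (wR f X')) (wR (wL X f) X')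
  symm : ∀ X Y : 𝓜, X * Y ⟶ Y * X
  symm_symm : ∀ X Y : 𝓜, symm X Y ≫ symm Y X = 𝟙 (X * Y)
  symm_natural_left : ∀ {X X' : 𝓜} (f : X ⟶ X') (Y : 𝓜),
    wR f Y ≫ symm X' Y = symm X Y ≫ wL Y f
  symm_natural_right : ∀ (X : 𝓜) {Y Y' : 𝓜} (f : Y ⟶ Y'),
    wL X f ≫ symm X Y' = symm X Y ≫ wR f X
  symm_central_left : ∀ (X Y : 𝓜) {Z Z' : 𝓜} (f : Z ⟶ Z'),
    wR (symm X Y) Z ≫ wL (Y * X) f = wL (X * Y) f ≫ wR (symm X Y) Z'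
  symm_central_right : ∀ (X Y : 𝓜) {Z Z' : 𝓜} (f : Z ⟶ Z'),
    wL Z (symm X Y) ≫ wR f (Y * X) = wR f (X * Y) ≫ wL Z' (symm X Y)
  hexagon : ∀ X Y Z : 𝓜, symm X (Y * Z) =
    eqToHom (mul_assoc X Y Z).symm ≫ wR (symm X Y) Z ≫ eqToHom (mul_assoc Y X Z) ≫
      wL Y (symm X Z) ≫ eqToHom (mul_assoc Y Z X).symm

open StrictSymmPremonoidal

section Circuits

variable {W : Type w} {𝓜 : Type u} [StrictSymmPremonoidal.{v} 𝓜] (ι : W → 𝓜)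

/-- The object of `𝓜` denoted by a sequence of wire types. -/
def obs (l : List W) : 𝓜 := (l.map ι).prod

theorem obs_append (l m : List W) : obs ι (l ++ m) = obs ι l * obs ι m := by
  simp [obs]

/-- The identity circuit between two equal sequences of wire types. -/
def same {l m : List W} (h : l = m) : obs ι l ⟶ obs ι m := eqToHom (congrArg (obs ι) h)

variable {ι}

/-- `m ⋊ f`. -/
def padL (m : List W) {l l' : List W} (f : obs ι l ⟶ obs ι l') :
    obs ι (m ++ l) ⟶ obs ι (m ++ l') :=
  eqToHom (obs_append ι m l) ≫ wL (obs ι m) f ≫ eqToHom (obs_append ι m l').symm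

/-- `f ⋉ m`. -/
def padR {l l' : List W} (f : obs ι l ⟶ obs ι l') (m : List W) :
    obs ι (l ++ m) ⟶ obs ι (l' ++ m) :=
  eqToHom (obs_append ι l m) ≫ wR f (obs ι m) ≫ eqToHom (obs_append ι l' m).symm

variable (ι)

/-- The symmetry exchanging two blocks of wires. -/
def swapBlocks (l m : List W) : obs ι (l ++ m) ⟶ obs ι (m ++ l) :=
  eqToHom (obs_append ι l m) ≫ symm (obs ι l) (obs ι m) ≫ eqToHom (obs_append ι m l).symm

end Circuits

/-! ### Label contexts and labelled circuits -/

/-- Wire labels. -/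
abbrev Label := ℕ

/-- Label contexts `ℓ₁ : w₁, …, ℓₙ : wₙ`.  Distinctness of the labels is imposed by the typing
judgments. -/
abbrev LCtx (W : Type w) := List (Label × W)

/-- The sequence of wire types of a label context. -/
abbrev LCtx.wires {W : Type w} (Q : LCtx W) : List W := List.map Prod.snd Q

/-- Renaming of labels in a label context. -/
def LCtx.rename {W : Type w} (ρ : Label → Label) (Q : LCtx W) : LCtx W :=
  List.map (fun p => (ρ p.1, p.2)) Q

theorem LCtx.wires_rename {W : Type w} (ρ : Label → Label) (Q : LCtx W) :
    (Q.rename ρ).wires = Q.wires := by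
  simp [LCtx.rename, LCtx.wires]

theorem LCtx.wires_append {W : Type w} (Q R : LCtx W) :
    LCtx.wires (Q ++ R) = Q.wires ++ R.wires := by
  simp [LCtx.wires]

/-- Permutations `Q ≅_σ Q'` of label contexts, as data. -/
inductive LPerm {W : Type w} : LCtx W → LCtx W → Type w
  | nil : LPerm [] []
  | cons (a : Label × W) {Q R : LCtx W} : LPerm Q R → LPerm (a :: Q) (a :: R)
  | swap (a b : Label × W) (Q : LCtx W) : LPerm (a :: b :: Q) (b :: a :: Q)
  | trans {Q R S : LCtx W} : LPerm Q R → LPerm R S → LPerm Q S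

section LabelledCircuits

variable {W : Type w} {𝓜 : Type u} [StrictSymmPremonoidal.{v} 𝓜] (ι : W → 𝓜)

/-- Labelled circuits `C : Q → L`: morphisms of `𝓜` between the interpretations of `Q` and `L`. -/
abbrev Circ (Q L : LCtx W) : Type v := obs ι Q.wires ⟶ obs ι L.wires

/-- The permutation isomorphism of `𝓜` induced by a permutation of label contexts. -/
def LPerm.perm : {Q R : LCtx W} → LPerm Q R → Circ ι Q R
  | _, _, .nil => 𝟙 _
  | _, _, .cons a σ => padL [a.2] σ.perm
  | _, _, .swap a b Q => padR (swapBlocks ι [a.2] [b.2]) Q.wires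
  | _, _, .trans σ τ => σ.perm ≫ τ.perm

end LabelledCircuits

/-! ### Types -/

/-- Bundle types `T, U ::= 𝟙 | w | T ⊗ U`. -/
inductive BTy (W : Type w) : Type w
  | unit : BTy W
  | wire (a : W) : BTy W
  | tensor (T U : BTy W) : BTy W

/-- Types.  In `arrow A B T` (the closure type `A ⊸_T B`) the annotation `T` is the type of the
wires captured by the closure; it is a bundle type up to associativity and unit laws of `⊗`, that
is a finite sequence of wire types. -/
inductive Ty (W : Type w) : Type w
  | unit : Ty W
  | nat : Ty W
  | wire (a : W) : Ty W
  | tensor (A B : Ty W) : Ty W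
  | bang (A : Ty W) : Ty W
  | circ (T U : BTy W) : Ty W
  | arrow (A B : Ty W) (T : List W) : Ty W

/-- Bundle types are types. -/
def BTy.toTy {W : Type w} : BTy W → Ty W
  | .unit => .unit
  | .wire a => .wire a
  | .tensor T U => .tensor T.toTy U.toTy

/-- Parameter types `P, R ::= 𝟙 | Nat | P ⊗ R | !A | Circ(T, U)`. -/
def Ty.IsParam {W : Type w} : Ty W → Prop
  | .unit => True
  | .nat => True
  | .wire _ => False
  | .tensor A B => A.IsParam ∧ B.IsParam
  | .bang _ => True
  | .circ _ _ => True
  | .arrow _ _ _ => False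

/-- The circuit part `♯A` of a type. -/
def Ty.wires {W : Type w} : Ty W → List W
  | .unit => []
  | .nat => []
  | .wire a => [a]
  | .tensor A B => A.wires ++ B.wires
  | .bang _ => []
  | .circ _ _ => []
  | .arrow _ _ T => T

/-- The wires of a bundle type. -/
abbrev BTy.wires {W : Type w} (T : BTy W) : List W := T.toTy.wires

theorem Ty.IsParam.wires_eq_nil {W : Type w} : ∀ {A : Ty W}, A.IsParam → A.wires = []
  | .unit, _ => rfl
  | .nat, _ => rfl
  | .tensor _ _, h => by simp [Ty.wires, h.1.wires_eq_nil, h.2.wires_eq_nil]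
  | .bang _, _ => rfl
  | .circ _ _, _ => rfl

/-! ### Terms (locally nameless: bound variables are de Bruijn indices) -/

/-- Wire bundles `ℓ⃗ ::= * | ℓ | (ℓ⃗, k⃗)`. -/
inductive Bundle : Type
  | unit : Bundle
  | lab (l : Label) : Bundle
  | pair (a b : Bundle) : Bundle

/-- Renaming of labels in a wire bundle. -/
def Bundle.rename (ρ : Label → Label) : Bundle → Bundle
  | .unit => .unit
  | .lab l => .lab (ρ l)
  | .pair a b => .pair (a.rename ρ) (b.rename ρ)

section Terms

variable {W : Type w} {𝓜 : Type u} [StrictSymmPremonoidal.{v} 𝓜] (ι : W → 𝓜)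

mutual

/-- Values. `boxed ℓ C k` is the boxed circuit `(ℓ⃗, C, k⃗)`. -/
inductive Val : Type (max v w)
  | unit : Val
  | nat (n : ℕ) : Val
  | bvar (i : ℕ) : Val
  | fvar (x : ℕ) : Val
  | lab (l : Label) : Val
  | lam (A : Ty W) (M : Comp) : Val
  | lift (M : Comp) : Val
  | boxed (l : Bundle) {Q L : LCtx W} (C : Circ ι Q L) (k : Bundle) : Val
  | pair (V₁ V₂ : Val) : Val

/-- Computations.  `lam A M` binds index `0` in `M`, and `letin M N` binds index `0` in `N`;
`dest V M`, which is `let (x, y) = V in M`, binds `x` as index `1` and `y` as index `0`. -/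
inductive Comp : Type (max v w)
  | app (V₁ V₂ : Val) : Comp
  | force (V : Val) : Comp
  | box (T : BTy W) (V : Val) : Comp
  | apply (V₁ V₂ : Val) : Comp
  | dest (V : Val) (M : Comp) : Comp
  | ifz (V : Val) (M N : Comp) : Comp
  | ret (V : Val) : Comp
  | letin (M N : Comp) : Comp

end

variable {ι}

/-- Wire bundles are values. -/
def Bundle.toVal : Bundle → Val ι
  | .unit => .unit
  | .lab l => .lab l
  | .pair a b => .pair a.toVal b.toVal

mutual

/-- Replace the bound variable `i` by the (locally closed) value `X`. -/
def Val.opn (X : Val ι) : ℕ → Val ι → Val ι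
  | _, .unit => .unit
  | _, .nat n => .nat n
  | i, .bvar j => if j = i then X else .bvar j
  | _, .fvar x => .fvar x
  | _, .lab l => .lab l
  | i, .lam A M => .lam A (M.opn X (i + 1))
  | i, .lift M => .lift (M.opn X i)
  | _, .boxed l C k => .boxed l C k
  | i, .pair V₁ V₂ => .pair (Val.opn X i V₁) (Val.opn X i V₂)

/-- Replace the bound variable `i` by the (locally closed) value `X`. -/
def Comp.opn (X : Val ι) : ℕ → Comp ι → Comp ι
  | i, .app V₁ V₂ => .app (Val.opn X i V₁) (Val.opn X i V₂)
  | i, .force V => .force (Val.opn X i V)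
  | i, .box T V => .box T (Val.opn X i V)
  | i, .apply V₁ V₂ => .apply (Val.opn X i V₁) (Val.opn X i V₂)
  | i, .dest V M => .dest (Val.opn X i V) (Comp.opn X (i + 2) M)
  | i, .ifz V M N => .ifz (Val.opn X i V) (Comp.opn X i M) (Comp.opn X i N)
  | i, .ret V => .ret (Val.opn X i V)
  | i, .letin M N => .letin (Comp.opn X i M) (Comp.opn X (i + 1) N)

end

mutual

/-- Free variables. -/
def Val.fv : Val ι → Finset ℕ
  | .unit => ∅
  | .nat _ => ∅
  | .bvar _ => ∅
  | .fvar x => {x}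
  | .lab _ => ∅
  | .lam _ M => M.fv
  | .lift M => M.fv
  | .boxed _ _ _ => ∅
  | .pair V₁ V₂ => V₁.fv ∪ V₂.fv

/-- Free variables. -/
def Comp.fv : Comp ι → Finset ℕ
  | .app V₁ V₂ => V₁.fv ∪ V₂.fv
  | .force V => V.fv
  | .box _ V => V.fv
  | .apply V₁ V₂ => V₁.fv ∪ V₂.fv
  | .dest V M => V.fv ∪ M.fv
  | .ifz V M N => V.fv ∪ M.fv ∪ N.fv
  | .ret V => V.fv
  | .letin M N => M.fv ∪ N.fv

end

mutual

/-- Labels occurring in a value, outside boxed circuits. -/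
def Val.labels : Val ι → Finset Label
  | .unit => ∅
  | .nat _ => ∅
  | .bvar _ => ∅
  | .fvar _ => ∅
  | .lab l => {l}
  | .lam _ M => M.labels
  | .lift M => M.labels
  | .boxed _ _ _ => ∅
  | .pair V₁ V₂ => V₁.labels ∪ V₂.labels

/-- Labels occurring in a computation, outside boxed circuits. -/
def Comp.labels : Comp ι → Finset Label
  | .app V₁ V₂ => V₁.labels ∪ V₂.labels
  | .force V => V.labels
  | .box _ V => V.labels
  | .apply V₁ V₂ => V₁.labels ∪ V₂.labels
  | .dest V M => V.labels ∪ M.labels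
  | .ifz V M N => V.labels ∪ M.labels ∪ N.labels
  | .ret V => V.labels
  | .letin M N => M.labels ∪ N.labels

end

end Terms

/-! ### Typing contexts -/

/-- Entries of a typing context: `x : A` for a variable `x`, or `ℓ : w` for a label `ℓ`. -/
inductive Entry (W : Type w) : Type w
  | var (x : ℕ) (A : Ty W) : Entry W
  | lab (l : Label) (a : W) : Entry W

/-- The name declared by an entry. -/
def Entry.name {W : Type w} : Entry W → ℕ ⊕ Label
  | .var x _ => .inl x
  | .lab l _ => .inr l

/-- The type declared by an entry. -/
def Entry.ty {W : Type w} : Entry W → Ty W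
  | .var _ A => A
  | .lab _ a => .wire a

/-- Typing contexts: ordered sequences of entries. -/
abbrev Ctx (W : Type w) := List (Entry W)

/-- The declared names are pairwise distinct. -/
def Ctx.WF {W : Type w} (Γ : Ctx W) : Prop := (List.map Entry.name Γ).Nodup

/-- Parameter contexts: variables of parameter types only. -/
def Ctx.IsParam {W : Type w} (Γ : Ctx W) : Prop :=
  ∀ e ∈ Γ, ∃ (x : ℕ) (A : Ty W), e = .var x A ∧ A.IsParam

/-- The circuit part `♯Γ` of a context. -/
def Ctx.wires {W : Type w} (Γ : Ctx W) : List W := List.flatMap (fun e => e.ty.wires) Γ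

/-- Label contexts are typing contexts. -/
def LCtx.toCtx {W : Type w} (Q : LCtx W) : Ctx W := List.map (fun p => Entry.lab p.1 p.2) Q

theorem Ctx.wires_append {W : Type w} (Γ Δ : Ctx W) :
    Ctx.wires (Γ ++ Δ) = Ctx.wires Γ ++ Ctx.wires Δ := by
  simp [Ctx.wires]

theorem Ctx.wires_single {W : Type w} (e : Entry W) : Ctx.wires [e] = e.ty.wires := by
  simp [Ctx.wires]

theorem Ctx.IsParam.wires_eq_nil {W : Type w} {Φ : Ctx W} (h : Φ.IsParam) : Φ.wires = [] := by
  simp only [Ctx.wires, List.flatMap_eq_nil_iff]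
  intro e he
  obtain ⟨x, A, rfl, hA⟩ := h e he
  exact hA.wires_eq_nil

theorem LCtx.wires_toCtx {W : Type w} (Q : LCtx W) : Q.toCtx.wires = Q.wires := by
  induction Q with
  | nil => rfl
  | cons a Q ih =>
    have h : Ctx.wires (LCtx.toCtx (a :: Q)) = a.2 :: Ctx.wires (LCtx.toCtx Q) := rfl
    rw [h, ih]
    rfl

/-! ### Typing judgments

Derivations are data, because the denotational semantics is defined on them. -/

section Typing

variable {W : Type w} {𝓜 : Type u} [StrictSymmPremonoidal.{v} 𝓜] {ι : W → 𝓜}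

mutual

/-- `Γ ⊢ V : A` for values. -/
inductive VTy : Ctx W → Val ι → Ty W → Type (max v w)
  | unit {Φ : Ctx W} (hΦ : Φ.IsParam) (hn : Φ.WF) : VTy Φ .unit .unit
  | nat {Φ : Ctx W} (hΦ : Φ.IsParam) (hn : Φ.WF) (n : ℕ) : VTy Φ (.nat n) .nat
  | lab {Φ : Ctx W} (hΦ : Φ.IsParam) (l : Label) (a : W)
      (hn : Ctx.WF (Φ ++ [.lab l a])) : VTy (Φ ++ [.lab l a]) (.lab l) (.wire a)
  | var {Φ : Ctx W} (hΦ : Φ.IsParam) (x : ℕ) (A : Ty W)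
      (hn : Ctx.WF (Φ ++ [.var x A])) : VTy (Φ ++ [.var x A]) (.fvar x) A
  | abs {Γ : Ctx W} {A B : Ty W} {M : Comp ι} (x : ℕ) (hx : x ∉ M.fv)
      (d : CTy (Γ ++ [.var x A]) (M.opn (.fvar x) 0) B) :
      VTy Γ (.lam A M) (.arrow A B Γ.wires)
  | lift {Φ : Ctx W} (hΦ : Φ.IsParam) {M : Comp ι} {A : Ty W} (d : CTy Φ M A) :
      VTy Φ (.lift M) (.bang A)
  | circ {Φ : Ctx W} (hΦ : Φ.IsParam) (hn : Φ.WF) {Q Q' L L' : LCtx W} (C : Circ ι Q L)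
      (σ : LPerm Q' Q) (τ : LPerm L L') {l k : Bundle} {T U : BTy W}
      (dl : VTy Q'.toCtx l.toVal T.toTy) (dk : VTy L'.toCtx k.toVal U.toTy) :
      VTy Φ (.boxed l C k) (.circ T U)
  | pair {Φ Γ₁ Γ₂ : Ctx W} (hΦ : Φ.IsParam) (hn : Ctx.WF (Φ ++ Γ₁ ++ Γ₂))
      {V₁ V₂ : Val ι} {A B : Ty W} (d₁ : VTy (Φ ++ Γ₁) V₁ A) (d₂ : VTy (Φ ++ Γ₂) V₂ B) :
      VTy (Φ ++ Γ₁ ++ Γ₂) (.pair V₁ V₂) (.tensor A B)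

/-- `Γ ⊢ M : A` for computations. -/
inductive CTy : Ctx W → Comp ι → Ty W → Type (max v w)
  | app {Φ Γ₁ Γ₂ : Ctx W} (hΦ : Φ.IsParam) (hn : Ctx.WF (Φ ++ Γ₁ ++ Γ₂))
      {V₁ V₂ : Val ι} {A B : Ty W} {T : List W}
      (d₁ : VTy (Φ ++ Γ₁) V₁ (.arrow A B T)) (d₂ : VTy (Φ ++ Γ₂) V₂ A) :
      CTy (Φ ++ Γ₁ ++ Γ₂) (.app V₁ V₂) B
  | force {Φ : Ctx W} (hΦ : Φ.IsParam) {V : Val ι} {A : Ty W} (d : VTy Φ V (.bang A)) :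
      CTy Φ (.force V) A
  | box {Φ : Ctx W} (hΦ : Φ.IsParam) {V : Val ι} {T U : BTy W}
      (d : VTy Φ V (.arrow T.toTy U.toTy [])) : CTy Φ (.box T V) (.circ T U)
  | apply {Φ Γ₁ Γ₂ : Ctx W} (hΦ : Φ.IsParam) (hn : Ctx.WF (Φ ++ Γ₁ ++ Γ₂))
      {V₁ V₂ : Val ι} {T U : BTy W}
      (d₁ : VTy (Φ ++ Γ₁) V₁ (.circ T U)) (d₂ : VTy (Φ ++ Γ₂) V₂ T.toTy) :
      CTy (Φ ++ Γ₁ ++ Γ₂) (.apply V₁ V₂) U.toTy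
  | dest {Φ Γ₁ Γ₂ : Ctx W} (hΦ : Φ.IsParam) (hn : Ctx.WF (Φ ++ Γ₂ ++ Γ₁))
      {V : Val ι} {M : Comp ι} {A B C : Ty W} (x y : ℕ) (hx : x ∉ M.fv) (hy : y ∉ M.fv)
      (d₁ : VTy (Φ ++ Γ₁) V (.tensor A B))
      (d₂ : CTy (Φ ++ Γ₂ ++ [.var x A, .var y B])
        ((M.opn (.fvar x) 1).opn (.fvar y) 0) C) :
      CTy (Φ ++ Γ₂ ++ Γ₁) (.dest V M) C
  | ifz {Φ Γ : Ctx W} (hΦ : Φ.IsParam) {V : Val ι} {M N : Comp ι} {A : Ty W}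
      (d : VTy Φ V .nat) (d₁ : CTy (Φ ++ Γ) M A) (d₂ : CTy (Φ ++ Γ) N A) :
      CTy (Φ ++ Γ) (.ifz V M N) A
  | ret {Γ : Ctx W} {V : Val ι} {A : Ty W} (d : VTy Γ V A) : CTy Γ (.ret V) A
  | letin {Φ Γ₁ Γ₂ : Ctx W} (hΦ : Φ.IsParam) (hn : Ctx.WF (Φ ++ Γ₂ ++ Γ₁))
      {M N : Comp ι} {A B : Ty W} (x : ℕ) (hx : x ∉ N.fv)
      (d₁ : CTy (Φ ++ Γ₁) M A) (d₂ : CTy (Φ ++ Γ₂ ++ [.var x A]) (N.opn (.fvar x) 0) B) :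
      CTy (Φ ++ Γ₂ ++ Γ₁) (.letin M N) B
  | ex {Γ₁ Γ₂ : Ctx W} {a b : Entry W} {M : Comp ι} {C : Ty W}
      (d : CTy (Γ₁ ++ [a] ++ [b] ++ Γ₂) M C) : CTy (Γ₁ ++ [b] ++ [a] ++ Γ₂) M C

end

/-- A value judgment `Γ ⊢ V : A` satisfies `♯Γ = ♯A`: values are interpreted by identity
circuits. -/
theorem VTy.wires_eq {Γ : Ctx W} {V : Val ι} {A : Ty W} (d : VTy Γ V A) :
    Γ.wires = A.wires := by
  match d with
  | .unit hΦ _ => exact hΦ.wires_eq_nil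
  | .nat hΦ _ _ => exact hΦ.wires_eq_nil
  | .lab hΦ l a _ =>
    rw [Ctx.wires_append, hΦ.wires_eq_nil, Ctx.wires_single]; rfl
  | .var hΦ x A _ =>
    rw [Ctx.wires_append, hΦ.wires_eq_nil, Ctx.wires_single]; rfl
  | .abs _ _ _ => rfl
  | .lift hΦ _ => exact hΦ.wires_eq_nil
  | .circ hΦ _ _ _ _ _ _ => exact hΦ.wires_eq_nil
  | .pair hΦ _ d₁ d₂ =>
    have h₁ := d₁.wires_eq
    have h₂ := d₂.wires_eq
    simp only [Ctx.wires_append, hΦ.wires_eq_nil, List.nil_append] at h₁ h₂ ⊢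
    simp only [Ty.wires, h₁, h₂]

end Typing

/-! ### Operational semantics -/

section Evaluation

variable {W : Type w} {𝓜 : Type u} [StrictSymmPremonoidal.{v} 𝓜] {ι : W → 𝓜}

/-- Append `E : Q → L` to `C`: the codomain of `C` is permuted (by `σ`) into the inputs of `E`,
relabelled by `ρ`, followed by remaining wires `R`, to which `E` is not applied; the outputs of `E`
are relabelled by `ρ'`. -/
def append {Q₀ K Q L R : LCtx W} (C : Circ ι Q₀ K) (E : Circ ι Q L) (ρ ρ' : Label → Label)
    (σ : LPerm K (Q.rename ρ ++ R)) : Circ ι Q₀ (L.rename ρ' ++ R) :=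
  C ≫ σ.perm ι ≫ same ι (by rw [LCtx.wires_append, LCtx.wires_rename]) ≫
    padR E R.wires ≫ same ι (by rw [LCtx.wires_append, LCtx.wires_rename])

/-- Big-step evaluation `(C, M) ⇓ (D, V)`. -/
inductive Eval : {Q K : LCtx W} → Circ ι Q K → Comp ι →
    {K' : LCtx W} → Circ ι Q K' → Val ι → Prop
  | app {Q K K' : LCtx W} {C : Circ ι Q K} {D : Circ ι Q K'} {A : Ty W} {M : Comp ι}
      {X V : Val ι} : Eval C (M.opn X 0) D V → Eval C (.app (.lam A M) X) D V
  | dest {Q K K' : LCtx W} {C : Circ ι Q K} {D : Circ ι Q K'} {M : Comp ι} {X Y V : Val ι} :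
      Eval C ((M.opn X 1).opn Y 0) D V → Eval C (.dest (.pair X Y) M) D V
  | force {Q K K' : LCtx W} {C : Circ ι Q K} {D : Circ ι Q K'} {M : Comp ι} {V : Val ι} :
      Eval C M D V → Eval C (.force (.lift M)) D V
  | ifzZero {Q K K' : LCtx W} {C : Circ ι Q K} {D : Circ ι Q K'} {M N : Comp ι} {V : Val ι} :
      Eval C M D V → Eval C (.ifz (.nat 0) M N) D V
  | ifzSucc {Q K K' : LCtx W} {C : Circ ι Q K} {D : Circ ι Q K'} {M N : Comp ι} {V : Val ι}
      (n : ℕ) : Eval C N D V → Eval C (.ifz (.nat (n + 1)) M N) D V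
  | ret {Q K : LCtx W} {C : Circ ι Q K} {V : Val ι} : Eval C (.ret V) C V
  | letin {Q K K' K'' : LCtx W} {C : Circ ι Q K} {D : Circ ι Q K'} {E : Circ ι Q K''}
      {M N : Comp ι} {X V : Val ι} :
      Eval C M E X → Eval E (N.opn X 0) D V → Eval C (.letin M N) D V
  /- `box` runs the function on fresh labels of the input type, starting from the identity. -/
  | box {Q K : LCtx W} {C : Circ ι Q K} {T : BTy W} {V : Val ι} {l k : Bundle}
      {Q₁ L₁ : LCtx W} {D : Circ ι Q₁ L₁} (dl : VTy (ι := ι) Q₁.toCtx l.toVal T.toTy)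
      (fresh : ∀ p ∈ Q₁, p.1 ∉ V.labels) :
      Eval (𝟙 _ : Circ ι Q₁ Q₁) (.app V l.toVal) D k.toVal →
      Eval C (.box T V) C (.boxed l D k)
  /- `apply` appends a renamed copy of the boxed circuit, whose inputs are the argument labels and
  whose outputs do not clash with the remaining labels. -/
  | apply {Q K Q₁ L₁ R : LCtx W} {C : Circ ι Q K} {l k : Bundle} (E : Circ ι Q₁ L₁)
      (ρ ρ' : Label → Label) (σ : LPerm K (Q₁.rename ρ ++ R))
      (fresh : (List.map Prod.fst (L₁.rename ρ' ++ R)).Nodup) :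
      Eval C (.apply (.boxed l E k) (l.rename ρ).toVal) (append C E ρ ρ' σ) (k.rename ρ').toVal

end Evaluation

/-! ### Denotational semantics -/

section Semantics

variable {W : Type w} {𝓜 : Type u} [StrictSymmPremonoidal.{v} 𝓜]

/-- The circuit monad `𝒯(S, U, X) = X × 𝓜(S, U)`. -/
abbrev CircMonad (S U : 𝓜) (X : Type v) : Type v := X × (S ⟶ U)

/-- Morphisms `(X, S) → (Y, U)` of the Kleisli category of the circuit monad. -/
abbrev KHom (X : Type v) (S : 𝓜) (Y : Type v) (U : 𝓜) : Type v := X → CircMonad S U Y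

/-- Kleisli composition. -/
def KHom.comp {X Y Z : Type v} {S U R : 𝓜} (f : KHom X S Y U) (g : KHom Y U Z R) :
    KHom X S Z R :=
  fun x => ((g (f x).1).1, (f x).2 ≫ (g (f x).1).2)

/-- Morphisms `(X, S) → (Y, U)` of `Set × 𝓜`. -/
abbrev VHom (X : Type v) (S : 𝓜) (Y : Type v) (U : 𝓜) : Type v := (X → Y) × (S ⟶ U)

/-- The identity-on-objects functor `J : Set × 𝓜 → Set_𝒯`. -/
def J {X Y : Type v} {S U : 𝓜} (f : VHom X S Y U) : KHom X S Y U := fun x => (f.1 x, f.2)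

variable (ι : W → 𝓜)

/-- The parameter part `♭⟦A⟧` of the interpretation of a type. -/
def Ty.val : Ty W → Type v
  | .unit => PUnit.{v + 1}
  | .nat => ULift ℕ
  | .wire _ => PUnit.{v + 1}
  | .tensor A B => A.val × B.val
  | .bang A => PUnit.{v + 1} → CircMonad (obs ι []) (obs ι A.wires) A.val
  | .circ T U => obs ι T.wires ⟶ obs ι U.wires
  | .arrow A B T => A.val → CircMonad (obs ι (T ++ A.wires)) (obs ι B.wires) B.val

/-- The unique element of `♭⟦T⟧` for a bundle type `T`. -/
def BTy.pt : (T : BTy W) → T.toTy.val ι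
  | .unit => PUnit.unit
  | .wire _ => PUnit.unit
  | .tensor T U => (T.pt, U.pt)

/-- The parameter part `♭⟦Γ⟧` of the interpretation of a context. -/
def Ctx.val : Ctx W → Type v
  | [] => PUnit.{v + 1}
  | e :: Γ => e.ty.val ι × Ctx.val Γ

variable {ι}

/-- `♭⟦Γ, Δ⟧ → ♭⟦Γ⟧ × ♭⟦Δ⟧`. -/
def Ctx.split : (Γ : Ctx W) → {Δ : Ctx W} → Ctx.val ι (Γ ++ Δ) → Ctx.val ι Γ × Ctx.val ι Δ
  | [], _, g => (PUnit.unit, g)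
  | _ :: Γ, _, g => ((g.1, (Ctx.split Γ g.2).1), (Ctx.split Γ g.2).2)

/-- `♭⟦Γ⟧ × ♭⟦Δ⟧ → ♭⟦Γ, Δ⟧`. -/
def Ctx.join : {Γ Δ : Ctx W} → Ctx.val ι Γ → Ctx.val ι Δ → Ctx.val ι (Γ ++ Δ)
  | [], _, _, d => d
  | _ :: _, _, g, d => (g.1, Ctx.join g.2 d)

/-- Duplicate the parameter context: `♭⟦Φ, Γ₁, Γ₂⟧ → ♭⟦Φ, Γ₁⟧ × ♭⟦Φ, Γ₂⟧`. -/
def Ctx.dup (Φ Γ₁ Γ₂ : Ctx W) (g : Ctx.val ι (Φ ++ Γ₁ ++ Γ₂)) :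
    Ctx.val ι (Φ ++ Γ₁) × Ctx.val ι (Φ ++ Γ₂) :=
  let p := Ctx.split (Φ ++ Γ₁) g
  (p.1, Ctx.join (Ctx.split Φ p.1).1 p.2)

/-- Exchange two entries: `♭⟦Γ₁, b, a, Γ₂⟧ → ♭⟦Γ₁, a, b, Γ₂⟧`. -/
def Ctx.exch (Γ₁ Γ₂ : Ctx W) (a b : Entry W) (g : Ctx.val ι (Γ₁ ++ [b] ++ [a] ++ Γ₂)) :
    Ctx.val ι (Γ₁ ++ [a] ++ [b] ++ Γ₂) :=
  let p := Ctx.split (Γ₁ ++ [b] ++ [a]) g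
  let q := Ctx.split (Γ₁ ++ [b]) p.1
  let r := Ctx.split Γ₁ q.1
  Ctx.join (Ctx.join (Ctx.join r.1 q.2) r.2) p.2

/-- The permutation circuit `♯(Γ₁, b, a, Γ₂) → ♯(Γ₁, a, b, Γ₂)`. -/
def Ctx.exchPerm (ι : W → 𝓜) (Γ₁ Γ₂ : Ctx W) (a b : Entry W) :
    obs ι (Ctx.wires (Γ₁ ++ [b] ++ [a] ++ Γ₂)) ⟶ obs ι (Ctx.wires (Γ₁ ++ [a] ++ [b] ++ Γ₂)) :=
  same ι (by simp only [Ctx.wires_append, Ctx.wires_single, List.append_assoc]) ≫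
    padL Γ₁.wires (padR (swapBlocks ι b.ty.wires a.ty.wires) Γ₂.wires) ≫
    same ι (by simp only [Ctx.wires_append, Ctx.wires_single, List.append_assoc])

mutual

/-- The function `♭⟦Γ⟧ → ♭⟦A⟧` of a value judgment; the circuit component of its
interpretation is the identity of `♯Γ = ♯A`. -/
def VTy.sem : {Γ : Ctx W} → {V : Val ι} → {A : Ty W} → VTy Γ V A → Ctx.val ι Γ → A.val ι
  | _, _, _, .unit _ _, _ => PUnit.unit
  | _, _, _, .nat _ _ n, _ => ULift.up n
  | _, _, _, .lab (Φ := Φ) _ _ _ _, g => (Ctx.split Φ g).2.1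
  | _, _, _, .var (Φ := Φ) _ _ _ _, g => (Ctx.split Φ g).2.1
  | _, _, _, .abs (A := A) _ _ d, g => fun a =>
      let r := d.sem (Ctx.join g (a, PUnit.unit))
      (r.1, same ι (by rw [Ctx.wires_append, Ctx.wires_single]; rfl) ≫ r.2)
  | _, _, _, .lift hΦ d, g => fun _ =>
      let r := d.sem g
      (r.1, same ι hΦ.wires_eq_nil.symm ≫ r.2)
  | _, _, _, .circ _ _ C σ τ dl dk, _ =>
      same ι (dl.wires_eq.symm.trans (LCtx.wires_toCtx _)) ≫ σ.perm ι ≫ C ≫ τ.perm ι ≫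
        same ι ((LCtx.wires_toCtx _).symm.trans dk.wires_eq)
  | _, _, _, .pair (Φ := Φ) (Γ₁ := Γ₁) (Γ₂ := Γ₂) _ _ d₁ d₂, g =>
      (d₁.sem (Ctx.dup Φ Γ₁ Γ₂ g).1, d₂.sem (Ctx.dup Φ Γ₁ Γ₂ g).2)

/-- The interpretation `♭⟦Γ⟧ → ♭⟦A⟧ × 𝓜(♯Γ, ♯A)` of a computation judgment, a morphism
`⟦Γ⟧ → ⟦A⟧` of the Kleisli category of the circuit monad. -/
def CTy.sem : {Γ : Ctx W} → {M : Comp ι} → {A : Ty W} → CTy Γ M A →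
    KHom (Ctx.val ι Γ) (obs ι Γ.wires) (A.val ι) (obs ι A.wires)
  | _, _, _, .app (Φ := Φ) (Γ₁ := Γ₁) (Γ₂ := Γ₂) hΦ _ d₁ d₂, g =>
      let r := d₁.sem (Ctx.dup Φ Γ₁ Γ₂ g).1 (d₂.sem (Ctx.dup Φ Γ₁ Γ₂ g).2)
      (r.1, same ι (by
        have h₁ := d₁.wires_eq
        have h₂ := d₂.wires_eq
        simp only [Ctx.wires_append, hΦ.wires_eq_nil, List.nil_append, Ty.wires] at h₁ h₂ ⊢
        rw [h₁, h₂]) ≫ r.2)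
  | _, _, _, .force hΦ d, g =>
      let r := d.sem g PUnit.unit
      (r.1, same ι hΦ.wires_eq_nil ≫ r.2)
  | _, _, _, .box (T := T) hΦ d, g =>
      ((d.sem g (T.pt ι)).2, same ι hΦ.wires_eq_nil)
  | _, _, _, .apply (Φ := Φ) (Γ₁ := Γ₁) (Γ₂ := Γ₂) (T := T) (U := U) hΦ _ d₁ d₂, g =>
      (U.pt ι, same ι (by
        have h₁ := d₁.wires_eq
        have h₂ := d₂.wires_eq
        simp only [Ctx.wires_append, hΦ.wires_eq_nil, List.nil_append] at h₁ h₂ ⊢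
        rw [h₁, h₂]; rfl) ≫ d₁.sem (Ctx.dup Φ Γ₁ Γ₂ g).1)
  | _, _, _, .dest (Φ := Φ) (Γ₁ := Γ₁) (Γ₂ := Γ₂) hΦ _ _ _ _ _ d₁ d₂, g =>
      let p := d₁.sem (Ctx.join (Ctx.split Φ (Ctx.split (Φ ++ Γ₂) g).1).1
        (Ctx.split (Φ ++ Γ₂) g).2)
      let r := d₂.sem (Ctx.join (Ctx.split (Φ ++ Γ₂) g).1 (p.1, p.2, PUnit.unit))
      (r.1, same ι (by
        have h₁ := d₁.wires_eq
        simp only [Ctx.wires_append, hΦ.wires_eq_nil, List.nil_append] at h₁ ⊢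
        rw [h₁]
        simp [Ctx.wires, Entry.ty, Ty.wires]) ≫ r.2)
  | _, _, _, .ifz (Φ := Φ) _ d d₁ d₂, g =>
      match (d.sem (Ctx.split Φ g).1).down with
      | 0 => d₁.sem g
      | _ + 1 => d₂.sem g
  | _, _, _, .ret d, g => (d.sem g, same ι d.wires_eq)
  | _, _, _, .letin (Φ := Φ) (Γ₁ := Γ₁) (Γ₂ := Γ₂) hΦ _ _ _ d₁ d₂, g =>
      let r := d₁.sem (Ctx.dup Φ Γ₂ Γ₁ g).2
      let s := d₂.sem (Ctx.join (Ctx.dup Φ Γ₂ Γ₁ g).1 (r.1, PUnit.unit))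
      (s.1, same ι (by
          simp only [Ctx.wires_append, hΦ.wires_eq_nil, List.nil_append]) ≫
        padL Γ₂.wires r.2 ≫
        same ι (by
          simp only [Ctx.wires_append, Ctx.wires_single, hΦ.wires_eq_nil, List.nil_append]
          rfl) ≫ s.2)
  | _, _, _, .ex (Γ₁ := Γ₁) (Γ₂ := Γ₂) (a := a) (b := b) d, g =>
      let r := d.sem (Ctx.exch Γ₁ Γ₂ a b g)
      (r.1, Ctx.exchPerm ι Γ₁ Γ₂ a b ≫ r.2)

end

/-- The element of `♭⟦Q⟧` for a label context `Q`. -/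
def LCtx.pt : (Q : LCtx W) → Ctx.val ι Q.toCtx
  | [] => PUnit.unit
  | _ :: Q => (PUnit.unit, LCtx.pt Q)

/-! ### Configurations -/

/-- `Q ⊢ (C, M) : A; Q'`: the circuit `C : Q → K` has as outputs, up to a permutation, a label
context `L` typing `M` and the label context `Q'`. -/
structure CompConfig {Q K : LCtx W} (C : Circ ι Q K) (M : Comp ι) (A : Ty W) (Q' : LCtx W) where
  dom_nodup : (List.map Prod.fst Q).Nodup
  L : LCtx W
  perm : LPerm K (L ++ Q')
  cod_nodup : (List.map Prod.fst (L ++ Q')).Nodup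
  deriv : CTy L.toCtx M A

/-- `Q ⊢ (C, V) : A; Q'` for a value `V`. -/
structure ValConfig {Q K : LCtx W} (C : Circ ι Q K) (V : Val ι) (A : Ty W) (Q' : LCtx W) where
  dom_nodup : (List.map Prod.fst Q).Nodup
  L : LCtx W
  perm : LPerm K (L ++ Q')
  cod_nodup : (List.map Prod.fst (L ++ Q')).Nodup
  deriv : VTy L.toCtx V A

/-- `⟦(C, M)⟧ = J(id, C); (⟦M⟧ ⋉ Q')`, a morphism `(1, ⟦Q⟧) → (♭⟦A⟧, ♯⟦A⟧ ⊗ ⟦Q'⟧)` of the Kleisli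
category; `C` is post-composed with the permutation to `L, Q'`. -/
def CompConfig.sem {Q K : LCtx W} {C : Circ ι Q K} {M : Comp ι} {A : Ty W} {Q' : LCtx W}
    (c : CompConfig C M A Q') :
    KHom PUnit.{v + 1} (obs ι Q.wires) (A.val ι) (obs ι (A.wires ++ Q'.wires)) :=
  KHom.comp (U := obs ι (c.L.toCtx.wires ++ Q'.wires))
    (J (fun _ => LCtx.pt c.L, C ≫ c.perm.perm ι ≫
      same ι (by rw [LCtx.wires_append, LCtx.wires_toCtx])))
    (fun g => ((c.deriv.sem g).1, padR (c.deriv.sem g).2 Q'.wires))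

/-- `⟦(C, V)⟧`, a morphism `(1, ⟦Q⟧) → (♭⟦A⟧, ♯⟦A⟧ ⊗ ⟦Q'⟧)` of `Set × 𝓜`. -/
def ValConfig.sem {Q K : LCtx W} {C : Circ ι Q K} {V : Val ι} {A : Ty W} {Q' : LCtx W}
    (c : ValConfig C V A Q') :
    VHom PUnit.{v + 1} (obs ι Q.wires) (A.val ι) (obs ι (A.wires ++ Q'.wires)) :=
  (fun _ => c.deriv.sem (LCtx.pt c.L), C ≫ c.perm.perm ι ≫
    same ι (by rw [LCtx.wires_append, ← c.deriv.wires_eq, LCtx.wires_toCtx]))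

end Semantics

end PQC

namespace PQC

open StrictSymmPremonoidal

/-! ### Circuits on sequences of wires -/

section Pads

variable {W : Type w} {𝓜 : Type u} [StrictSymmPremonoidal.{v} 𝓜]

theorem wL_heq {X X' Y Y' Z Z' : 𝓜} {f : Y ⟶ Z} {f' : Y' ⟶ Z'} (hX : X = X') (hY : Y = Y')
    (hZ : Z = Z') (hf : HEq f f') : HEq (wL X f) (wL X' f') := by
  subst hX hY hZ; cases hf; rfl

theorem wR_heq {X X' Y Y' Z Z' : 𝓜} {f : Y ⟶ Z} {f' : Y' ⟶ Z'} (hX : X = X') (hY : Y = Y')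
    (hZ : Z = Z') (hf : HEq f f') : HEq (wR f X) (wR f' X') := by
  subst hX hY hZ; cases hf; rfl

theorem comp_heq' {X X' Y Y' Z Z' : 𝓜} {f : X ⟶ Y} {g : Y ⟶ Z} {f' : X' ⟶ Y'} {g' : Y' ⟶ Z'}
    (hX : X = X') (hY : Y = Y') (hZ : Z = Z') (hf : HEq f f') (hg : HEq g g') :
    HEq (f ≫ g) (f' ≫ g') := by
  subst hX hY hZ; cases hf; cases hg; rfl

theorem symm_heq {X X' Y Y' : 𝓜} (hX : X = X') (hY : Y = Y') :
    HEq (symm X Y) (symm X' Y') := by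
  subst hX hY; rfl

theorem eqToHom_sandwich_heq {X X' Y Y' : 𝓜} (f : X ⟶ Y) (hX : X' = X) (hY : Y = Y') :
    HEq (eqToHom hX ≫ f ≫ eqToHom hY) f := by
  subst hX hY; simp

theorem eqToHom_heq' {X Y X' Y' : 𝓜} (h : X = Y) (h' : X' = Y') (hX : X = X') :
    HEq (eqToHom h) (eqToHom h') := by
  subst hX h h'; rfl

theorem symm_one_right (X : 𝓜) : symm X 1 = eqToHom (by rw [mul_one, one_mul]) := by
  have h := hexagon X (1 : 𝓜) 1
  have h₁ : HEq (symm X (1 * 1 : 𝓜)) (symm X 1) := symm_heq rfl (one_mul 1)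
  have h₂ : HEq (symm X (1 * 1 : 𝓜))
      (symm X 1 ≫ eqToHom (by rw [mul_one, one_mul]) ≫ symm X 1) := by
    rw [h]
    rw [eqToHom_comp_heq_iff]
    refine comp_heq' (by simp) (by simp) (by simp) (wR_unit _) ?_
    refine comp_heq' (by simp) (by simp) (by simp) ?_ ?_
    · exact eqToHom_heq' _ _ (by simp)
    · rw [comp_eqToHom_heq_iff]
      exact wL_unit _
  have h₃ := eq_of_heq (h₁.symm.trans h₂)
  have h₄ := congrArg (symm 1 X ≫ ·) h₃
  simp only [← Category.assoc, symm_symm] at h₄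
  rw [Category.id_comp] at h₄
  have h₅ := congrArg (eqToHom (show X * 1 = 1 * X by rw [mul_one, one_mul]) ≫ ·) h₄.symm
  simpa using h₅

theorem symm_one_left (X : 𝓜) : symm 1 X = eqToHom (by rw [mul_one, one_mul]) := by
  have h := symm_symm (1 : 𝓜) X
  rw [symm_one_right] at h
  have h'' := congrArg (fun f => f ≫ eqToHom (show 1 * X = X * 1 by rw [mul_one, one_mul])) h
  simpa using h''

theorem hexagon' (X Y Z : 𝓜) : symm (X * Y) Z =
    eqToHom (mul_assoc X Y Z) ≫ wL X (symm Y Z) ≫ eqToHom (mul_assoc X Z Y).symm ≫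
      wR (symm X Z) Y ≫ eqToHom (mul_assoc Z X Y) := by
  have key : symm Z (X * Y) ≫ (eqToHom (mul_assoc X Y Z) ≫ wL X (symm Y Z) ≫
      eqToHom (mul_assoc X Z Y).symm ≫ wR (symm X Z) Y ≫ eqToHom (mul_assoc Z X Y)) = 𝟙 _ := by
    rw [hexagon]
    have h₁ : wL X (symm Z Y) ≫ wL X (symm Y Z) = 𝟙 _ := by rw [← wL_comp, symm_symm, wL_id]
    have h₂ : wR (symm Z X) Y ≫ wR (symm X Z) Y = 𝟙 _ := by rw [← wR_comp, symm_symm, wR_id]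
    simp only [Category.assoc, eqToHom_trans_assoc, eqToHom_refl, Category.id_comp]
    rw [reassoc_of% h₁]
    simp only [eqToHom_trans_assoc, eqToHom_refl, Category.id_comp]
    rw [reassoc_of% h₂]
    simp
  calc symm (X * Y) Z = symm (X * Y) Z ≫ 𝟙 _ := (Category.comp_id _).symm
    _ = _ := by rw [← key, ← Category.assoc, symm_symm, Category.id_comp]

variable {ι : W → 𝓜}

theorem same_rfl {l : List W} (h : l = l) : same ι h = 𝟙 _ := rfl

theorem same_comp_same {l m n : List W} (h : l = m) (h' : m = n) :
    same ι h ≫ same ι h' = same ι (h.trans h') := by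
  subst h h'; simp [same]

theorem same_comp_same_assoc {l m n k : List W} (h : l = m) (h' : m = n)
    (f : obs ι n ⟶ obs ι k) : same ι h ≫ same ι h' ≫ f = same ι (h.trans h') ≫ f := by
  rw [← Category.assoc, same_comp_same]

theorem eq_same_of_heq {l l' m m' : List W} {f : obs ι l ⟶ obs ι l'} {g : obs ι m ⟶ obs ι m'}
    (h : l = m) (h' : m' = l') (hfg : HEq f g) : f = same ι h ≫ g ≫ same ι h' := by
  subst h h'; cases hfg; simp [same]

theorem padR_heq {l l' : List W} (f : obs ι l ⟶ obs ι l') (m : List W) :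
    HEq (padR f m) (wR f (obs ι m)) := eqToHom_sandwich_heq _ _ _

theorem padL_heq {l l' : List W} (m : List W) (f : obs ι l ⟶ obs ι l') :
    HEq (padL m f) (wL (obs ι m) f) := eqToHom_sandwich_heq _ _ _

theorem padR_comp {l l' l'' : List W} (f : obs ι l ⟶ obs ι l') (g : obs ι l' ⟶ obs ι l'')
    (m : List W) : padR (f ≫ g) m = padR f m ≫ padR g m := by
  simp [padR, wR_comp]

theorem padL_comp {l l' l'' : List W} (f : obs ι l ⟶ obs ι l') (g : obs ι l' ⟶ obs ι l'')
    (m : List W) : padL m (f ≫ g) = padL m f ≫ padL m g := by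
  simp [padL, wL_comp]

theorem padR_id (l m : List W) : padR (𝟙 (obs ι l)) m = 𝟙 _ := by
  simp [padR, wR_id]

theorem padL_id (l m : List W) : padL m (𝟙 (obs ι l)) = 𝟙 _ := by
  simp [padL, wL_id]

theorem padR_same {l l' : List W} (h : l = l') (m : List W) :
    padR (same ι h) m = same ι (by rw [h]) := by
  subst h; exact padR_id _ _

theorem padL_same {l l' : List W} (h : l = l') (m : List W) :
    padL m (same ι h) = same ι (by rw [h]) := by
  subst h; exact padL_id _ _

theorem padR_congr {l l' m m' : List W} (f : obs ι l ⟶ obs ι l') (h : m = m') :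
    padR f m = same ι (by rw [h]) ≫ padR f m' ≫ same ι (by rw [h]) := by
  subst h; simp [same]

theorem padL_nil {l l' : List W} (f : obs ι l ⟶ obs ι l') : padL [] f = f :=
  eq_of_heq ((padL_heq _ _).trans (wL_unit f))

theorem padR_nil {l l' : List W} (f : obs ι l ⟶ obs ι l') :
    padR f [] = same ι (by simp) ≫ f ≫ same ι (by simp) :=
  eq_same_of_heq _ _ ((padR_heq _ _).trans (wR_unit f))

theorem padR_padR {l l' : List W} (f : obs ι l ⟶ obs ι l') (m m' : List W) :
    padR (padR f m) m' = same ι (by simp) ≫ padR f (m ++ m') ≫ same ι (by simp) := by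
  refine eq_same_of_heq _ _ ((padR_heq _ _).trans ?_)
  refine (wR_heq rfl (obs_append ..) (obs_append ..) (padR_heq _ _)).trans ?_
  refine (wR_tensor _ _ _).symm.trans ?_
  exact (wR_heq (obs_append ..).symm rfl rfl HEq.rfl).trans (padR_heq _ _).symm

theorem padL_padL {l l' : List W} (f : obs ι l ⟶ obs ι l') (m m' : List W) :
    padL (m ++ m') f = same ι (by simp) ≫ padL m (padL m' f) ≫ same ι (by simp) := by
  refine eq_same_of_heq _ _ (HEq.symm ?_)
  refine (padL_heq _ _).trans ?_
  refine (wL_heq rfl (obs_append ..) (obs_append ..) (padL_heq _ _)).trans ?_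
  refine (wL_tensor _ _ _).symm.trans ?_
  exact (wL_heq (obs_append ..).symm rfl rfl HEq.rfl).trans (padL_heq _ _).symm

theorem padL_padR {l l' : List W} (m : List W) (f : obs ι l ⟶ obs ι l') (m' : List W) :
    padL m (padR f m') = same ι (by simp) ≫ padR (padL m f) m' ≫ same ι (by simp) := by
  refine eq_same_of_heq _ _ ((padL_heq _ _).trans ?_)
  refine (wL_heq rfl (obs_append ..) (obs_append ..) (padR_heq _ _)).trans ?_
  refine (wL_wR _ _ _).trans ?_
  refine (wR_heq rfl (obs_append ..).symm (obs_append ..).symm (padL_heq _ _).symm).trans ?_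
  exact (padR_heq _ _).symm

theorem swapBlocks_heq (l m : List W) : HEq (swapBlocks ι l m) (symm (obs ι l) (obs ι m)) :=
  eqToHom_sandwich_heq _ _ _

theorem swapBlocks_swapBlocks (l m : List W) :
    swapBlocks ι l m ≫ swapBlocks ι m l = 𝟙 _ := by
  simp [swapBlocks, reassoc_of% (symm_symm (obs ι l) (obs ι m))]

theorem padR_swapBlocks {l l' : List W} (f : obs ι l ⟶ obs ι l') (m : List W) :
    padR f m ≫ swapBlocks ι l' m = swapBlocks ι l m ≫ padL m f := by
  simp [padR, padL, swapBlocks, reassoc_of% (symm_natural_left f (obs ι m))]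

theorem swapBlocks_nil_right (l : List W) : swapBlocks ι l [] = same ι (by simp) := by
  have h : symm (obs ι l) (obs ι []) = eqToHom (by simp [obs]) := symm_one_right _
  simp [swapBlocks, h, same]

theorem swapBlocks_nil_left (l : List W) : swapBlocks ι [] l = same ι (by simp) := by
  have h : symm (obs ι []) (obs ι l) = eqToHom (by simp [obs]) := symm_one_left _
  simp [swapBlocks, h, same]

theorem swapBlocks_append_right (l m n : List W) : swapBlocks ι l (m ++ n) =
    same ι (by simp) ≫ padR (swapBlocks ι l m) n ≫ same ι (by simp) ≫
      padL m (swapBlocks ι l n) ≫ same ι (by simp) := by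
  refine eq_of_heq ((swapBlocks_heq _ _).trans ?_)
  refine (symm_heq rfl (obs_append ..)).trans ?_
  rw [hexagon]
  refine comp_heq' (by simp [obs_append]) (by simp [obs_append, mul_assoc])
    (by simp [obs_append, mul_assoc]) (eqToHom_heq' _ _ (by simp [obs_append])) ?_
  refine comp_heq' (by simp [obs_append, mul_assoc]) (by simp [obs_append, mul_assoc])
    (by simp [obs_append, mul_assoc]) ?_ ?_
  · exact (wR_heq rfl (obs_append ..).symm (obs_append ..).symm (swapBlocks_heq _ _).symm).trans
      (padR_heq _ _).symm
  refine comp_heq' (by simp [obs_append, mul_assoc]) (by simp [obs_append])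
    (by simp [obs_append, mul_assoc])
    (eqToHom_heq' _ _ (by simp [obs_append, mul_assoc])) ?_
  refine comp_heq' (by simp [obs_append]) (by simp [obs_append])
    (by simp [obs_append, mul_assoc]) ?_
    (eqToHom_heq' _ _ (by simp [obs_append]))
  exact (wL_heq rfl (obs_append ..).symm (obs_append ..).symm (swapBlocks_heq _ _).symm).trans
      (padL_heq _ _).symm

theorem swapBlocks_append_left (l m n : List W) : swapBlocks ι (l ++ m) n =
    same ι (by simp) ≫ padL l (swapBlocks ι m n) ≫ same ι (by simp) ≫
      padR (swapBlocks ι l n) m ≫ same ι (by simp) := by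
  refine eq_of_heq ((swapBlocks_heq _ _).trans ?_)
  refine (symm_heq (obs_append ..) rfl).trans ?_
  rw [hexagon']
  refine comp_heq' (by simp [obs_append, mul_assoc]) (by simp [obs_append])
    (by simp [obs_append]) (eqToHom_heq' _ _ (by simp [obs_append, mul_assoc])) ?_
  refine comp_heq' (by simp [obs_append]) (by simp [obs_append])
    (by simp [obs_append]) ?_ ?_
  · exact (wL_heq rfl (obs_append ..).symm (obs_append ..).symm (swapBlocks_heq _ _).symm).trans
      (padL_heq _ _).symm
  refine comp_heq' (by simp [obs_append]) (by simp [obs_append, mul_assoc]) (by simp [obs_append])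
    (eqToHom_heq' _ _ (by simp [obs_append])) ?_
  refine comp_heq' (by simp [obs_append, mul_assoc]) (by simp [obs_append, mul_assoc])
    (by simp [obs_append]) ?_
    (eqToHom_heq' _ _ (by simp [obs_append, mul_assoc]))
  exact (wR_heq rfl (obs_append ..).symm (obs_append ..).symm (swapBlocks_heq _ _).symm).trans
      (padR_heq _ _).symm

theorem padL_congr {l l' m m' : List W} (f : obs ι l ⟶ obs ι l') (h : m = m') :
    padL m f = same ι (by rw [h]) ≫ padL m' f ≫ same ι (by rw [h]) := by
  subst h; simp [same]

theorem swapBlocks_congr {l l' m m' : List W} (h : l = l') (h' : m = m') :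
    swapBlocks ι l m =
      same ι (by rw [h, h']) ≫ swapBlocks ι l' m' ≫ same ι (by rw [h, h']) := by
  subst h h'; simp [same]

end Pads

/-! ### Permutations of label contexts -/

namespace LPerm

variable {W : Type w} {𝓜 : Type u} [StrictSymmPremonoidal.{v} 𝓜] (ι : W → 𝓜)

theorem toPerm {Q R : LCtx W} (σ : LPerm Q R) : List.Perm Q R := by
  induction σ with
  | nil => exact .nil
  | cons a _ ih => exact .cons a ih
  | swap a b Q => exact .swap b a Q
  | trans _ _ ih₁ ih₂ => exact ih₁.trans ih₂

/-- The identity permutation. -/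
def refl : (Q : LCtx W) → LPerm Q Q
  | [] => .nil
  | a :: Q => .cons a (refl Q)

theorem perm_refl : (Q : LCtx W) → (refl Q).perm ι = 𝟙 _
  | [] => rfl
  | a :: Q => by
    rw [refl, perm, perm_refl Q]; exact padL_id _ _

/-- The identity permutation between equal label contexts. -/
def ofEq {Q R : LCtx W} (h : Q = R) : LPerm Q R := h ▸ refl Q

theorem perm_ofEq {Q R : LCtx W} (h : Q = R) :
    (ofEq h).perm ι = same ι (congrArg LCtx.wires h) := by
  subst h; exact perm_refl ι Q

/-- Extend a permutation by the identity on the right. -/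
def appR : {Q Q' : LCtx W} → LPerm Q Q' → (R : LCtx W) → LPerm (Q ++ R) (Q' ++ R)
  | _, _, .nil, R => refl R
  | _, _, .cons a σ, R => .cons a (σ.appR R)
  | _, _, .swap a b Q, R => .swap a b (Q ++ R)
  | _, _, .trans σ τ, R => .trans (σ.appR R) (τ.appR R)

theorem perm_appR {Q Q' : LCtx W} (σ : LPerm Q Q') (R : LCtx W) : (σ.appR R).perm ι =
    same ι (LCtx.wires_append Q R) ≫ padR (σ.perm ι) R.wires ≫
      same ι (LCtx.wires_append Q' R).symm := by
  induction σ with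
  | nil =>
    refine (perm_refl ι R).trans ?_
    rw [perm, padR_id, Category.id_comp, same_comp_same]
    rfl
  | cons a σ ih =>
    rw [appR, perm, ih, perm, padL_comp, padL_comp, padL_same, padL_same, padL_padR]
    simp only [Category.assoc, same_comp_same, same_comp_same_assoc]
  | swap a b Q =>
    rw [appR, perm, perm, padR_padR, padR_congr _ (LCtx.wires_append Q R)]
    simp only [Category.assoc, same_comp_same, same_comp_same_assoc]
  | trans σ τ ih₁ ih₂ =>
    rw [appR, perm, ih₁, ih₂, perm, padR_comp]
    simp only [Category.assoc, same_comp_same_assoc, same_rfl, Category.id_comp]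

/-- Extend a permutation by the identity on the left. -/
def appL {Q Q' : LCtx W} : (R : LCtx W) → LPerm Q Q' → LPerm (R ++ Q) (R ++ Q')
  | [], σ => σ
  | a :: R, σ => .cons a (appL R σ)

theorem perm_appL {Q Q' : LCtx W} (R : LCtx W) (σ : LPerm Q Q') : (appL R σ).perm ι =
    same ι (LCtx.wires_append R Q) ≫ padL R.wires (σ.perm ι) ≫
      same ι (LCtx.wires_append R Q').symm := by
  induction R with
  | nil =>
    have h : padL (LCtx.wires ([] : LCtx W)) (σ.perm ι) = σ.perm ι := padL_nil _
    rw [h]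
    exact ((Category.id_comp _).trans (Category.comp_id _)).symm
  | cons a R ih =>
    have h : padL (LCtx.wires (a :: R)) (σ.perm ι) = _ := padL_padL (σ.perm ι) [a.2] (LCtx.wires R)
    rw [h, appL, perm, ih, padL_comp, padL_comp, padL_same, padL_same]
    simp only [Category.assoc, same_comp_same, same_comp_same_assoc]

/-- Move a label to the end. -/
def snoc (a : Label × W) : (Q : LCtx W) → LPerm (a :: Q) (Q ++ [a])
  | [] => refl [a]
  | b :: Q => .trans (.swap a b Q) (.cons b (snoc a Q))

theorem perm_snoc (a : Label × W) (Q : LCtx W) : (snoc a Q).perm ι =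
    swapBlocks ι [a.2] Q.wires ≫ same ι (LCtx.wires_append Q [a]).symm := by
  induction Q with
  | nil =>
    rw [snoc, perm_refl]
    have h : swapBlocks ι [a.2] (LCtx.wires ([] : LCtx W)) = _ := swapBlocks_nil_right [a.2]
    rw [h, same_comp_same]; rfl
  | cons b Q ih =>
    have h : swapBlocks ι [a.2] (LCtx.wires (b :: Q)) = _ :=
      swapBlocks_append_right [a.2] [b.2] (LCtx.wires Q)
    rw [snoc, perm, perm, perm, ih, h, padL_comp, padL_same]
    simp only [Category.assoc, same_rfl, Category.id_comp]

/-- Exchange two blocks of labels. -/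
def blocks : (Q R : LCtx W) → LPerm (Q ++ R) (R ++ Q)
  | [], R => ofEq (by simp)
  | a :: Q, R => .trans (.cons a (blocks Q R))
      (.trans ((snoc a R).appR Q) (ofEq (by simp)))

theorem perm_blocks (Q R : LCtx W) : (blocks Q R).perm ι =
    same ι (LCtx.wires_append Q R) ≫ swapBlocks ι Q.wires R.wires ≫
      same ι (LCtx.wires_append R Q).symm := by
  induction Q with
  | nil =>
    have h : swapBlocks ι (LCtx.wires ([] : LCtx W)) R.wires = _ := swapBlocks_nil_left R.wires
    rw [blocks, perm_ofEq, h, same_comp_same, same_comp_same]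
  | cons a Q ih =>
    have h : swapBlocks ι (LCtx.wires (a :: Q)) R.wires = _ :=
      swapBlocks_append_left [a.2] (LCtx.wires Q) (LCtx.wires R)
    rw [blocks, perm, perm, perm, ih, h, perm_ofEq, perm_appR, perm_snoc, padL_comp, padL_comp,
      padL_same, padL_same, padR_comp, padR_same]
    simp only [Category.assoc, same_comp_same, same_comp_same_assoc]

/-- Rename the labels of a permutation. -/
def rename (ρ : Label → Label) : {Q R : LCtx W} → LPerm Q R → LPerm (Q.rename ρ) (R.rename ρ)
  | _, _, .nil => .nil
  | _, _, .cons a σ => .cons (ρ a.1, a.2) (σ.rename ρ)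
  | _, _, .swap a b Q => .swap (ρ a.1, a.2) (ρ b.1, b.2) (Q.rename ρ)
  | _, _, .trans σ τ => .trans (σ.rename ρ) (τ.rename ρ)

theorem perm_rename (ρ : Label → Label) {Q R : LCtx W} (σ : LPerm Q R) :
    (σ.rename ρ).perm ι = same ι (LCtx.wires_rename ρ Q) ≫ σ.perm ι ≫
      same ι (LCtx.wires_rename ρ R).symm := by
  induction σ with
  | nil => exact ((Category.id_comp _).trans (Category.comp_id _)).symm
  | cons a σ ih =>
    refine (congrArg (padL [a.2]) ih).trans ?_
    rw [perm, padL_comp, padL_comp, padL_same, padL_same]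
    rfl
  | swap a b Q =>
    exact padR_congr (swapBlocks ι [a.2] [b.2]) (LCtx.wires_rename ρ Q)
  | trans σ τ ih₁ ih₂ =>
    rw [rename, perm, ih₁, ih₂, perm]
    simp only [Category.assoc, same_comp_same_assoc, same_rfl, Category.id_comp]

theorem eq_nil {Q : LCtx W} (σ : LPerm Q []) : Q = [] := σ.toPerm.eq_nil

theorem perm_eq_same {Q R : LCtx W} (σ : LPerm Q R) (hR : R = []) (h : Q.wires = R.wires) :
    σ.perm ι = same ι h := by
  induction σ with
  | nil => rfl
  | cons => cases hR
  | swap => cases hR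
  | trans σ τ ih₁ ih₂ =>
    subst hR
    obtain rfl := τ.eq_nil
    rw [perm, ih₁ rfl h, ih₂ rfl rfl, same_comp_same]

end LPerm

/-! ### Substitution and local closure -/

section Substitution

variable {W : Type w} {𝓜 : Type u} [StrictSymmPremonoidal.{v} 𝓜] {ι : W → 𝓜}

mutual

/-- Simultaneous substitution of the free variables. -/
def Val.subst (γ : ℕ → Val ι) : Val ι → Val ι
  | .unit => .unit
  | .nat n => .nat n
  | .bvar j => .bvar j
  | .fvar x => γ x
  | .lab l => .lab l
  | .lam A M => .lam A (M.subst γ)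
  | .lift M => .lift (M.subst γ)
  | .boxed l C k => .boxed l C k
  | .pair V₁ V₂ => .pair (V₁.subst γ) (V₂.subst γ)

/-- Simultaneous substitution of the free variables. -/
def Comp.subst (γ : ℕ → Val ι) : Comp ι → Comp ι
  | .app V₁ V₂ => .app (V₁.subst γ) (V₂.subst γ)
  | .force V => .force (V.subst γ)
  | .box T V => .box T (V.subst γ)
  | .apply V₁ V₂ => .apply (V₁.subst γ) (V₂.subst γ)
  | .dest V M => .dest (V.subst γ) (M.subst γ)
  | .ifz V M N => .ifz (V.subst γ) (M.subst γ) (N.subst γ)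
  | .ret V => .ret (V.subst γ)
  | .letin M N => .letin (M.subst γ) (N.subst γ)

end

mutual

/-- All bound variables are smaller than `k`. -/
def Val.LC : ℕ → Val ι → Prop
  | _, .unit => True
  | _, .nat _ => True
  | k, .bvar j => j < k
  | _, .fvar _ => True
  | _, .lab _ => True
  | k, .lam _ M => M.LC (k + 1)
  | k, .lift M => M.LC k
  | _, .boxed _ _ _ => True
  | k, .pair V₁ V₂ => Val.LC k V₁ ∧ Val.LC k V₂

/-- All bound variables are smaller than `k`. -/
def Comp.LC : ℕ → Comp ι → Prop
  | k, .app V₁ V₂ => Val.LC k V₁ ∧ Val.LC k V₂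
  | k, .force V => Val.LC k V
  | k, .box _ V => Val.LC k V
  | k, .apply V₁ V₂ => Val.LC k V₁ ∧ Val.LC k V₂
  | k, .dest V M => Val.LC k V ∧ Comp.LC (k + 2) M
  | k, .ifz V M N => Val.LC k V ∧ Comp.LC k M ∧ Comp.LC k N
  | k, .ret V => Val.LC k V
  | k, .letin M N => Comp.LC k M ∧ Comp.LC (k + 1) N

end

mutual

theorem Val.LC.mono : ∀ {V : Val ι} {k k' : ℕ}, V.LC k → k ≤ k' → V.LC k'
  | .unit, _, _, _, _ => trivial
  | .nat _, _, _, _, _ => trivial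
  | .bvar _, _, _, h, hk => lt_of_lt_of_le (show _ < _ from h) hk
  | .fvar _, _, _, _, _ => trivial
  | .lab _, _, _, _, _ => trivial
  | .lam _ M, _, _, h, hk => Comp.LC.mono (V := M) h (Nat.succ_le_succ hk)
  | .lift M, _, _, h, hk => Comp.LC.mono (V := M) h hk
  | .boxed _ _ _, _, _, _, _ => trivial
  | .pair _ _, _, _, h, hk => ⟨h.1.mono hk, h.2.mono hk⟩

theorem Comp.LC.mono : ∀ {V : Comp ι} {k k' : ℕ}, V.LC k → k ≤ k' → V.LC k'
  | .app _ _, _, _, h, hk => ⟨h.1.mono hk, h.2.mono hk⟩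
  | .force V, _, _, h, hk => Val.LC.mono (V := V) h hk
  | .box _ V, _, _, h, hk => Val.LC.mono (V := V) h hk
  | .apply _ _, _, _, h, hk => ⟨h.1.mono hk, h.2.mono hk⟩
  | .dest _ _, _, _, h, hk => ⟨h.1.mono hk, h.2.mono (by omega)⟩
  | .ifz _ _ _, _, _, h, hk => ⟨h.1.mono hk, h.2.1.mono hk, h.2.2.mono hk⟩
  | .ret V, _, _, h, hk => Val.LC.mono (V := V) h hk
  | .letin _ _, _, _, h, hk => ⟨h.1.mono hk, h.2.mono (by omega)⟩

end

mutual

theorem Val.opn_of_LC (X : Val ι) : ∀ (V : Val ι) (i : ℕ), V.LC i → Val.opn X i V = V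
  | .unit, _, _ => rfl
  | .nat _, _, _ => rfl
  | .bvar j, i, h => if_neg (show j < i from h).ne
  | .fvar _, _, _ => rfl
  | .lab _, _, _ => rfl
  | .lam A M, i, h => congrArg (Val.lam A) (Comp.opn_of_LC X M (i + 1) h)
  | .lift M, i, h => congrArg Val.lift (Comp.opn_of_LC X M i h)
  | .boxed _ _ _, _, _ => rfl
  | .pair V₁ V₂, i, h =>
    congrArg₂ Val.pair (Val.opn_of_LC X V₁ i h.1) (Val.opn_of_LC X V₂ i h.2)

theorem Comp.opn_of_LC (X : Val ι) : ∀ (M : Comp ι) (i : ℕ), M.LC i → Comp.opn X i M = M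
  | .app V₁ V₂, i, h =>
    congrArg₂ Comp.app (Val.opn_of_LC X V₁ i h.1) (Val.opn_of_LC X V₂ i h.2)
  | .force V, i, h => congrArg Comp.force (Val.opn_of_LC X V i h)
  | .box T V, i, h => congrArg (Comp.box T) (Val.opn_of_LC X V i h)
  | .apply V₁ V₂, i, h =>
    congrArg₂ Comp.apply (Val.opn_of_LC X V₁ i h.1) (Val.opn_of_LC X V₂ i h.2)
  | .dest V M, i, h =>
    congrArg₂ Comp.dest (Val.opn_of_LC X V i h.1) (Comp.opn_of_LC X M (i + 2) h.2)
  | .ifz V M N, i, h => by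
    rw [Comp.opn, Val.opn_of_LC X V i h.1, Comp.opn_of_LC X M i h.2.1,
      Comp.opn_of_LC X N i h.2.2]
  | .ret V, i, h => congrArg Comp.ret (Val.opn_of_LC X V i h)
  | .letin M N, i, h =>
    congrArg₂ Comp.letin (Comp.opn_of_LC X M i h.1) (Comp.opn_of_LC X N (i + 1) h.2)

end

mutual

theorem Val.LC_of_opn {X : Val ι} : ∀ (V : Val ι) (k i : ℕ), i ≤ k → (Val.opn X i V).LC k →
    V.LC (k + 1)
  | .unit, _, _, _, _ => trivial
  | .nat _, _, _, _, _ => trivial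
  | .bvar j, k, i, hi, h => by
    by_cases hj : j = i
    · show j < k + 1
      omega
    · rw [Val.opn, if_neg hj] at h
      exact Nat.lt_succ_of_lt h
  | .fvar _, _, _, _, _ => trivial
  | .lab _, _, _, _, _ => trivial
  | .lam _ M, k, i, hi, h => Comp.LC_of_opn M (k + 1) (i + 1) (by omega) h
  | .lift M, k, i, hi, h => Comp.LC_of_opn M k i hi h
  | .boxed _ _ _, _, _, _, _ => trivial
  | .pair V₁ V₂, k, i, hi, h => ⟨Val.LC_of_opn V₁ k i hi h.1, Val.LC_of_opn V₂ k i hi h.2⟩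

theorem Comp.LC_of_opn {X : Val ι} : ∀ (M : Comp ι) (k i : ℕ), i ≤ k → (Comp.opn X i M).LC k →
    M.LC (k + 1)
  | .app V₁ V₂, k, i, hi, h => ⟨Val.LC_of_opn V₁ k i hi h.1, Val.LC_of_opn V₂ k i hi h.2⟩
  | .force V, k, i, hi, h => Val.LC_of_opn V k i hi h
  | .box _ V, k, i, hi, h => Val.LC_of_opn V k i hi h
  | .apply V₁ V₂, k, i, hi, h => ⟨Val.LC_of_opn V₁ k i hi h.1, Val.LC_of_opn V₂ k i hi h.2⟩
  | .dest V M, k, i, hi, h =>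
    ⟨Val.LC_of_opn V k i hi h.1, Comp.LC_of_opn M (k + 2) (i + 2) (by omega) h.2⟩
  | .ifz V M N, k, i, hi, h =>
    ⟨Val.LC_of_opn V k i hi h.1, Comp.LC_of_opn M k i hi h.2.1, Comp.LC_of_opn N k i hi h.2.2⟩
  | .ret V, k, i, hi, h => Val.LC_of_opn V k i hi h
  | .letin M N, k, i, hi, h =>
    ⟨Comp.LC_of_opn M k i hi h.1, Comp.LC_of_opn N (k + 1) (i + 1) (by omega) h.2⟩

end

mutual

theorem Val.LC.subst {γ : ℕ → Val ι} (hγ : ∀ x, (γ x).LC 0) : ∀ (V : Val ι) (k : ℕ), V.LC k →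
    (V.subst γ).LC k
  | .unit, _, _ => trivial
  | .nat _, _, _ => trivial
  | .bvar _, _, h => h
  | .fvar x, k, _ => (hγ x).mono (Nat.zero_le k)
  | .lab _, _, _ => trivial
  | .lam _ M, k, h => Comp.LC.subst hγ M (k + 1) h
  | .lift M, k, h => Comp.LC.subst hγ M k h
  | .boxed _ _ _, _, _ => trivial
  | .pair V₁ V₂, k, h => ⟨Val.LC.subst hγ V₁ k h.1, Val.LC.subst hγ V₂ k h.2⟩

theorem Comp.LC.subst {γ : ℕ → Val ι} (hγ : ∀ x, (γ x).LC 0) : ∀ (M : Comp ι) (k : ℕ), M.LC k →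
    (M.subst γ).LC k
  | .app V₁ V₂, k, h => ⟨Val.LC.subst hγ V₁ k h.1, Val.LC.subst hγ V₂ k h.2⟩
  | .force V, k, h => Val.LC.subst hγ V k h
  | .box _ V, k, h => Val.LC.subst hγ V k h
  | .apply V₁ V₂, k, h => ⟨Val.LC.subst hγ V₁ k h.1, Val.LC.subst hγ V₂ k h.2⟩
  | .dest V M, k, h => ⟨Val.LC.subst hγ V k h.1, Comp.LC.subst hγ M (k + 2) h.2⟩
  | .ifz V M N, k, h =>
    ⟨Val.LC.subst hγ V k h.1, Comp.LC.subst hγ M k h.2.1, Comp.LC.subst hγ N k h.2.2⟩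
  | .ret V, k, h => Val.LC.subst hγ V k h
  | .letin M N, k, h => ⟨Comp.LC.subst hγ M k h.1, Comp.LC.subst hγ N (k + 1) h.2⟩

end

mutual

theorem Val.subst_opn {γ : ℕ → Val ι} (hγ : ∀ x, (γ x).LC 0) (X : Val ι) :
    ∀ (V : Val ι) (i : ℕ), (Val.opn X i V).subst γ = Val.opn (X.subst γ) i (V.subst γ)
  | .unit, _ => rfl
  | .nat _, _ => rfl
  | .bvar j, i => by
    by_cases hj : j = i
    · simp [Val.opn, Val.subst, hj]
    · simp [Val.opn, Val.subst, hj]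
  | .fvar x, i => (Val.opn_of_LC _ _ i ((hγ x).mono (Nat.zero_le i))).symm
  | .lab _, _ => rfl
  | .lam A M, i => congrArg (Val.lam A) (Comp.subst_opn hγ X M (i + 1))
  | .lift M, i => congrArg Val.lift (Comp.subst_opn hγ X M i)
  | .boxed _ _ _, _ => rfl
  | .pair V₁ V₂, i => congrArg₂ Val.pair (Val.subst_opn hγ X V₁ i) (Val.subst_opn hγ X V₂ i)

theorem Comp.subst_opn {γ : ℕ → Val ι} (hγ : ∀ x, (γ x).LC 0) (X : Val ι) :
    ∀ (M : Comp ι) (i : ℕ), (Comp.opn X i M).subst γ = Comp.opn (X.subst γ) i (M.subst γ)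
  | .app V₁ V₂, i => congrArg₂ Comp.app (Val.subst_opn hγ X V₁ i) (Val.subst_opn hγ X V₂ i)
  | .force V, i => congrArg Comp.force (Val.subst_opn hγ X V i)
  | .box T V, i => congrArg (Comp.box T) (Val.subst_opn hγ X V i)
  | .apply V₁ V₂, i => congrArg₂ Comp.apply (Val.subst_opn hγ X V₁ i) (Val.subst_opn hγ X V₂ i)
  | .dest V M, i => congrArg₂ Comp.dest (Val.subst_opn hγ X V i) (Comp.subst_opn hγ X M (i + 2))
  | .ifz V M N, i => by
    simp only [Comp.opn, Comp.subst, Val.subst_opn hγ X V i, Comp.subst_opn hγ X M i,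
      Comp.subst_opn hγ X N i]
  | .ret V, i => congrArg Comp.ret (Val.subst_opn hγ X V i)
  | .letin M N, i =>
    congrArg₂ Comp.letin (Comp.subst_opn hγ X M i) (Comp.subst_opn hγ X N (i + 1))

end

mutual

theorem Val.subst_congr {γ γ' : ℕ → Val ι} : ∀ (V : Val ι), (∀ x ∈ V.fv, γ x = γ' x) →
    V.subst γ = V.subst γ'
  | .unit, _ => rfl
  | .nat _, _ => rfl
  | .bvar _, _ => rfl
  | .fvar x, h => h x (by simp [Val.fv])
  | .lab _, _ => rfl
  | .lam A M, h => congrArg (Val.lam A) (Comp.subst_congr M h)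
  | .lift M, h => congrArg Val.lift (Comp.subst_congr M h)
  | .boxed _ _ _, _ => rfl
  | .pair V₁ V₂, h => congrArg₂ Val.pair
      (Val.subst_congr V₁ fun x hx => h x (by simp [Val.fv, hx]))
      (Val.subst_congr V₂ fun x hx => h x (by simp [Val.fv, hx]))

theorem Comp.subst_congr {γ γ' : ℕ → Val ι} : ∀ (M : Comp ι), (∀ x ∈ M.fv, γ x = γ' x) →
    M.subst γ = M.subst γ'
  | .app V₁ V₂, h => congrArg₂ Comp.app
      (Val.subst_congr V₁ fun x hx => h x (by simp [Comp.fv, hx]))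
      (Val.subst_congr V₂ fun x hx => h x (by simp [Comp.fv, hx]))
  | .force V, h => congrArg Comp.force (Val.subst_congr V h)
  | .box T V, h => congrArg (Comp.box T) (Val.subst_congr V h)
  | .apply V₁ V₂, h => congrArg₂ Comp.apply
      (Val.subst_congr V₁ fun x hx => h x (by simp [Comp.fv, hx]))
      (Val.subst_congr V₂ fun x hx => h x (by simp [Comp.fv, hx]))
  | .dest V M, h => congrArg₂ Comp.dest
      (Val.subst_congr V fun x hx => h x (by simp [Comp.fv, hx]))
      (Comp.subst_congr M fun x hx => h x (by simp [Comp.fv, hx]))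
  | .ifz V M N, h => by
    rw [Comp.subst, Comp.subst, Val.subst_congr V fun x hx => h x (by simp [Comp.fv, hx]),
      Comp.subst_congr M fun x hx => h x (by simp [Comp.fv, hx]),
      Comp.subst_congr N fun x hx => h x (by simp [Comp.fv, hx])]
  | .ret V, h => congrArg Comp.ret (Val.subst_congr V h)
  | .letin M N, h => congrArg₂ Comp.letin
      (Comp.subst_congr M fun x hx => h x (by simp [Comp.fv, hx]))
      (Comp.subst_congr N fun x hx => h x (by simp [Comp.fv, hx]))

end

mutual

theorem Val.subst_fvar : ∀ (V : Val ι), V.subst .fvar = V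
  | .unit => rfl
  | .nat _ => rfl
  | .bvar _ => rfl
  | .fvar _ => rfl
  | .lab _ => rfl
  | .lam A M => congrArg (Val.lam A) (Comp.subst_fvar M)
  | .lift M => congrArg Val.lift (Comp.subst_fvar M)
  | .boxed _ _ _ => rfl
  | .pair V₁ V₂ => congrArg₂ Val.pair (Val.subst_fvar V₁) (Val.subst_fvar V₂)

theorem Comp.subst_fvar : ∀ (M : Comp ι), M.subst .fvar = M
  | .app V₁ V₂ => congrArg₂ Comp.app (Val.subst_fvar V₁) (Val.subst_fvar V₂)
  | .force V => congrArg Comp.force (Val.subst_fvar V)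
  | .box T V => congrArg (Comp.box T) (Val.subst_fvar V)
  | .apply V₁ V₂ => congrArg₂ Comp.apply (Val.subst_fvar V₁) (Val.subst_fvar V₂)
  | .dest V M => congrArg₂ Comp.dest (Val.subst_fvar V) (Comp.subst_fvar M)
  | .ifz V M N => by rw [Comp.subst, Val.subst_fvar V, Comp.subst_fvar M, Comp.subst_fvar N]
  | .ret V => congrArg Comp.ret (Val.subst_fvar V)
  | .letin M N => congrArg₂ Comp.letin (Comp.subst_fvar M) (Comp.subst_fvar N)

end

theorem Bundle.subst_toVal (γ : ℕ → Val ι) : ∀ b : Bundle, (b.toVal (ι := ι)).subst γ = b.toVal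
  | .unit => rfl
  | .lab _ => rfl
  | .pair a b => congrArg₂ Val.pair (a.subst_toVal γ) (b.subst_toVal γ)

/-- Substituting for a fresh variable replaces the bound variable. -/
theorem Comp.subst_update_opn {γ : ℕ → Val ι} (hγ : ∀ x, (γ x).LC 0) {x : ℕ} {X : Val ι}
    (hX : X.LC 0) {M : Comp ι} (hx : x ∉ M.fv) :
    (M.opn (.fvar x) 0).subst (Function.update γ x X) = (M.subst γ).opn X 0 := by
  have hγ' : ∀ y, (Function.update γ x X y).LC 0 := by
    intro y
    rcases eq_or_ne y x with rfl | hy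
    · simpa using hX
    · simpa [hy] using hγ y
  rw [Comp.subst_opn hγ', Val.subst, Function.update_self]
  congr 1
  refine Comp.subst_congr M fun y hy => ?_
  rw [Function.update_of_ne]
  rintro rfl
  exact hx hy

theorem Comp.subst_update_opn₂ {γ : ℕ → Val ι} (hγ : ∀ x, (γ x).LC 0) {x y : ℕ} (hxy : x ≠ y)
    {X Y : Val ι} (hX : X.LC 0) (hY : Y.LC 0) {M : Comp ι} (hx : x ∉ M.fv) (hy : y ∉ M.fv) :
    ((M.opn (.fvar x) 1).opn (.fvar y) 0).subst
      (Function.update (Function.update γ x X) y Y) = ((M.subst γ).opn X 1).opn Y 0 := by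
  have hγ' : ∀ z, (Function.update (Function.update γ x X) y Y z).LC 0 := by
    intro z
    rcases eq_or_ne z y with rfl | hz
    · simpa using hY
    · rcases eq_or_ne z x with rfl | hz'
      · simpa [hz] using hX
      · simpa [hz, hz'] using hγ z
  rw [Comp.subst_opn hγ', Comp.subst_opn hγ', Val.subst, Val.subst, Function.update_self,
    Function.update_of_ne hxy, Function.update_self]
  congr 2
  refine Comp.subst_congr M fun z hz => ?_
  rw [Function.update_of_ne, Function.update_of_ne]
  · rintro rfl
    exact hx hz
  · rintro rfl
    exact hy hz

mutual

theorem VTy.LC : ∀ {Γ : Ctx W} {V : Val ι} {A : Ty W}, VTy Γ V A → V.LC 0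
  | _, _, _, .unit _ _ => trivial
  | _, _, _, .nat _ _ _ => trivial
  | _, _, _, .lab _ _ _ _ => trivial
  | _, _, _, .var _ _ _ _ => trivial
  | _, _, _, .abs _ _ d => Comp.LC_of_opn _ 0 0 le_rfl d.LC
  | _, _, _, .lift _ d => d.LC
  | _, _, _, .circ _ _ _ _ _ _ _ => trivial
  | _, _, _, .pair _ _ d₁ d₂ => ⟨d₁.LC, d₂.LC⟩

theorem CTy.LC : ∀ {Γ : Ctx W} {M : Comp ι} {A : Ty W}, CTy Γ M A → M.LC 0
  | _, _, _, .app _ _ d₁ d₂ => ⟨d₁.LC, d₂.LC⟩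
  | _, _, _, .force _ d => d.LC
  | _, _, _, .box _ d => d.LC
  | _, _, _, .apply _ _ d₁ d₂ => ⟨d₁.LC, d₂.LC⟩
  | _, _, _, .dest _ _ _ _ _ _ d₁ d₂ =>
    ⟨d₁.LC, Comp.LC_of_opn _ 1 1 le_rfl (Comp.LC_of_opn _ 0 0 le_rfl d₂.LC)⟩
  | _, _, _, .ifz _ d d₁ d₂ => ⟨d.LC, d₁.LC, d₂.LC⟩
  | _, _, _, .ret d => d.LC
  | _, _, _, .letin _ _ _ _ d₁ d₂ => ⟨d₁.LC, Comp.LC_of_opn _ 0 0 le_rfl d₂.LC⟩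
  | _, _, _, .ex d => d.LC

end

theorem Ctx.WF.left {Γ Δ : Ctx W} (h : Ctx.WF (Γ ++ Δ)) : Ctx.WF Γ := by
  unfold Ctx.WF at h ⊢
  rw [List.map_append] at h
  exact h.of_append_left

mutual

theorem VTy.wf : ∀ {Γ : Ctx W} {V : Val ι} {A : Ty W}, VTy Γ V A → Γ.WF
  | _, _, _, .unit _ hn => hn
  | _, _, _, .nat _ hn _ => hn
  | _, _, _, .lab _ _ _ hn => hn
  | _, _, _, .var _ _ _ hn => hn
  | _, _, _, .abs _ _ d => d.wf.left
  | _, _, _, .lift _ d => d.wf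
  | _, _, _, .circ _ hn _ _ _ _ _ => hn
  | _, _, _, .pair _ hn _ _ => hn

theorem CTy.wf : ∀ {Γ : Ctx W} {M : Comp ι} {A : Ty W}, CTy Γ M A → Γ.WF
  | _, _, _, .app _ hn _ _ => hn
  | _, _, _, .force _ d => d.wf
  | _, _, _, .box _ d => d.wf
  | _, _, _, .apply _ hn _ _ => hn
  | _, _, _, .dest _ hn _ _ _ _ _ _ => hn
  | _, _, _, .ifz _ _ d₁ _ => d₁.wf
  | _, _, _, .ret d => d.wf
  | _, _, _, .letin _ hn _ _ _ _ => hn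
  | _, _, _, .ex (Γ₁ := Γ₁) (Γ₂ := Γ₂) (a := a) (b := b) d => by
    have h := d.wf
    unfold Ctx.WF at h ⊢
    refine (List.Perm.nodup_iff (List.Perm.map _ ?_)).mp h
    simp only [List.append_assoc, List.singleton_append]
    exact List.Perm.append_left Γ₁ (List.Perm.swap b a Γ₂)

end

end Substitution

/-! ### Wire bundles -/

section Bundles

variable {W : Type w} {𝓜 : Type u} [StrictSymmPremonoidal.{v} 𝓜] {ι : W → 𝓜}

/-- The labels of `Q`, in order, form the wire bundle `b` of type `T`. -/
def BTy.Rel : BTy W → Bundle → LCtx W → Prop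
  | .unit, b, Q => b = .unit ∧ Q = []
  | .wire a, b, Q => ∃ l, b = .lab l ∧ Q = [(l, a)]
  | .tensor T U, b, Q => ∃ b₁ b₂ Q₁ Q₂, b = .pair b₁ b₂ ∧ Q = Q₁ ++ Q₂ ∧ T.Rel b₁ Q₁ ∧ U.Rel b₂ Q₂

theorem BTy.Rel.wires_eq : ∀ {T : BTy W} {b : Bundle} {Q : LCtx W}, T.Rel b Q →
    LCtx.wires Q = T.wires
  | .unit, _, _, ⟨_, h⟩ => by subst h; rfl
  | .wire _, _, _, ⟨_, _, h⟩ => by subst h; rfl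
  | .tensor _ _, _, _, ⟨_, _, _, _, _, h, h₁, h₂⟩ => by
    subst h
    rw [LCtx.wires_append, h₁.wires_eq, h₂.wires_eq]; rfl

theorem BTy.Rel.length_eq {T : BTy W} {b : Bundle} {Q : LCtx W} (h : T.Rel b Q) :
    Q.length = T.wires.length := by
  rw [← h.wires_eq, List.length_map]

theorem BTy.Rel.unique : ∀ {T : BTy W} {b b' : Bundle} {Q : LCtx W}, T.Rel b Q → T.Rel b' Q →
    b = b'
  | .unit, _, _, _, ⟨h, _⟩, ⟨h', _⟩ => h.trans h'.symm
  | .wire _, _, _, _, ⟨l, h, hQ⟩, ⟨l', h', hQ'⟩ => by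
    subst hQ h h'
    obtain ⟨rfl⟩ : l = l' := by simpa using hQ'
    rfl
  | .tensor _ _, _, _, _, ⟨_, _, _, _, h, hQ, h₁, h₂⟩, ⟨_, _, _, _, h', hQ', h₁', h₂'⟩ => by
    subst h h' hQ
    obtain ⟨rfl, rfl⟩ := List.append_inj hQ' (h₁.length_eq.trans h₁'.length_eq.symm)
    rw [h₁.unique h₁', h₂.unique h₂']

theorem LCtx.rename_append (ρ : Label → Label) (Q R : LCtx W) :
    LCtx.rename ρ (Q ++ R) = Q.rename ρ ++ R.rename ρ := by
  simp [LCtx.rename]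

theorem BTy.Rel.rename (ρ : Label → Label) : ∀ {T : BTy W} {b : Bundle} {Q : LCtx W},
    T.Rel b Q → T.Rel (b.rename ρ) (Q.rename ρ)
  | .unit, _, _, ⟨h, hQ⟩ => by subst h hQ; exact ⟨rfl, rfl⟩
  | .wire _, _, _, ⟨_, h, hQ⟩ => by subst h hQ; exact ⟨_, rfl, rfl⟩
  | .tensor _ _, _, _, ⟨_, _, _, _, h, hQ, h₁, h₂⟩ => by
    subst h hQ
    exact ⟨_, _, _, _, rfl, LCtx.rename_append .., h₁.rename ρ, h₂.rename ρ⟩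

theorem LCtx.exists_rename : ∀ {Q L : LCtx W}, (List.map Prod.fst Q).Nodup → Q.wires = L.wires →
    ∃ ρ : Label → Label, Q.rename ρ = L
  | [], [], _, _ => ⟨id, rfl⟩
  | [], _ :: _, _, h => by simp [LCtx.wires] at h
  | _ :: _, [], _, h => by simp [LCtx.wires] at h
  | p :: Q, q :: L, hn, h => by
    simp only [LCtx.wires, List.map_cons, List.cons.injEq] at h
    simp only [List.map_cons, List.nodup_cons] at hn
    obtain ⟨ρ, rfl⟩ := LCtx.exists_rename (Q := Q) (L := L) hn.2 h.2
    refine ⟨Function.update ρ p.1 q.1, ?_⟩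
    simp only [LCtx.rename, List.map_cons, Function.update_self, h.1, List.cons.injEq, true_and]
    refine List.map_congr_left fun r hr => ?_
    rw [Function.update_of_ne]
    intro hrp
    exact hn.1 (hrp ▸ List.mem_map_of_mem hr)

theorem LCtx.toCtx_append (Q R : LCtx W) : LCtx.toCtx (Q ++ R) = Q.toCtx ++ R.toCtx := by
  simp [LCtx.toCtx]

theorem LCtx.toCtx_wf {Q : LCtx W} : Q.toCtx.WF ↔ (List.map Prod.fst Q).Nodup := by
  have h : List.map Entry.name Q.toCtx = List.map (Sum.inr : Label → ℕ ⊕ Label)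
      (List.map Prod.fst Q) := by
    simp [LCtx.toCtx, Entry.name]
  rw [Ctx.WF, h, List.nodup_map_iff Sum.inr_injective]

theorem Ctx.isParam_nil : Ctx.IsParam ([] : Ctx W) := by simp [Ctx.IsParam]

theorem BTy.Rel.typing : ∀ {T : BTy W} {b : Bundle} {Q : LCtx W}, T.Rel b Q →
    (List.map Prod.fst Q).Nodup → Nonempty (VTy (ι := ι) Q.toCtx b.toVal T.toTy)
  | .unit, _, _, ⟨h, hQ⟩, _ => by
    subst h hQ
    exact ⟨.unit Ctx.isParam_nil (by simp [Ctx.WF, LCtx.toCtx])⟩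
  | .wire a, _, _, ⟨l, h, hQ⟩, _ => by
    subst h hQ
    exact ⟨.lab (Φ := []) Ctx.isParam_nil l a (by simp [Ctx.WF])⟩
  | .tensor _ _, _, _, ⟨_, _, Q₁, Q₂, h, hQ, h₁, h₂⟩, hn => by
    subst h hQ
    have hn' := LCtx.toCtx_wf.mpr hn
    rw [List.map_append] at hn
    obtain ⟨d₁⟩ := h₁.typing hn.of_append_left
    obtain ⟨d₂⟩ := h₂.typing hn.of_append_right
    rw [LCtx.toCtx_append] at hn' ⊢
    exact ⟨.pair (Φ := []) Ctx.isParam_nil hn' d₁ d₂⟩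

/-- Every bundle type is inhabited by a bundle of fresh labels. -/
theorem BTy.exists_rel : ∀ (T : BTy W) (n : ℕ), ∃ (b : Bundle) (Q : LCtx W) (m : ℕ), n ≤ m ∧
    T.Rel b Q ∧ (List.map Prod.fst Q).Nodup ∧ ∀ p ∈ Q, n ≤ p.1 ∧ p.1 < m
  | .unit, n => ⟨.unit, [], n, le_rfl, ⟨rfl, rfl⟩, by simp, by simp⟩
  | .wire a, n => ⟨.lab n, [(n, a)], n + 1, by omega, ⟨_, rfl, rfl⟩, by simp, by simp⟩
  | .tensor T U, n => by
    obtain ⟨b₁, Q₁, m₁, hm₁, h₁, hn₁, hl₁⟩ := T.exists_rel n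
    obtain ⟨b₂, Q₂, m₂, hm₂, h₂, hn₂, hl₂⟩ := U.exists_rel m₁
    refine ⟨.pair b₁ b₂, Q₁ ++ Q₂, m₂, hm₁.trans hm₂, ⟨_, _, _, _, rfl, rfl, h₁, h₂⟩, ?_, ?_⟩
    · rw [List.map_append, List.nodup_append]
      refine ⟨hn₁, hn₂, fun x hx y hy => ?_⟩
      obtain ⟨p, hp, rfl⟩ := List.mem_map.mp hx
      obtain ⟨q, hq, rfl⟩ := List.mem_map.mp hy
      exact ((hl₁ p hp).2.trans_le (hl₂ q hq).1).ne
    · intro p hp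
      rcases List.mem_append.mp hp with hp | hp
      · exact ⟨(hl₁ p hp).1, (hl₁ p hp).2.trans_le hm₂⟩
      · exact ⟨hm₁.trans (hl₂ p hp).1, (hl₂ p hp).2⟩

/-- Shifted labels avoid any given finite set of labels. -/
theorem LCtx.exists_nodup_rename {L : LCtx W} (hL : (List.map Prod.fst L).Nodup) (R : LCtx W)
    (hR : (List.map Prod.fst R).Nodup) :
    ∃ ρ : Label → Label, (List.map Prod.fst (L.rename ρ ++ R)).Nodup := by
  obtain ⟨n, hn⟩ : ∃ n, ∀ l ∈ List.map Prod.fst R, l < n := by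
    refine ⟨(List.map Prod.fst R).sum + 1, fun l hl => ?_⟩
    exact Nat.lt_succ_of_le (List.le_sum_of_mem hl)
  have hinj : Function.Injective (fun l : Label => l + n) := fun a b h => by simpa using h
  refine ⟨fun l => l + n, ?_⟩
  have h : List.map Prod.fst (LCtx.rename (fun l => l + n) L) =
      List.map (fun l => l + n) (List.map Prod.fst L) := by simp [LCtx.rename]
  rw [List.map_append, List.nodup_append, h]
  refine ⟨hL.map hinj, hR, ?_⟩
  rintro x hx y hy rfl
  obtain ⟨z, -, rfl⟩ := List.mem_map.mp hx
  exact (hn _ hy).not_ge (Nat.le_add_left n z)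

end Bundles

/-! ### The logical relation -/

section LogicalRelation

variable {W : Type w} {𝓜 : Type u} [StrictSymmPremonoidal.{v} 𝓜] {ι : W → 𝓜}

/-- Started with any circuit whose outputs are `L` and further labels `R`, the computation `M`
evaluates to a value satisfying `P`, and the circuit is extended by `c`. -/
def Run (P : Val ι → LCtx W → Prop) (M : Comp ι) (L : LCtx W) {T U : List W}
    (c : obs ι T ⟶ obs ι U) : Prop :=
  ∀ ⦃Q K : LCtx W⦄ (C : Circ ι Q K) (R : LCtx W) (σ : LPerm K (L ++ R)),
    (List.map Prod.fst (L ++ R)).Nodup →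
    ∃ (K' : LCtx W) (D : Circ ι Q K') (V : Val ι) (L' : LCtx W) (σ' : LPerm K' (L' ++ R)),
      (List.map Prod.fst (L' ++ R)).Nodup ∧ Eval C M D V ∧ P V L' ∧
      ∃ (h : LCtx.wires (L ++ R) = T ++ R.wires) (h' : U ++ R.wires = LCtx.wires (L' ++ R)),
        D ≫ σ'.perm ι = C ≫ σ.perm ι ≫ same ι h ≫ padR c R.wires ≫ same ι h'

/-- The closed value `V`, which owns the labels `L`, realizes an element of `♭⟦A⟧`. -/
def Ty.Rel : (A : Ty W) → Val ι → LCtx W → A.val ι → Prop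
  | .unit, V, L, _ => V = .unit ∧ L = []
  | .nat, V, L, n => V = .nat n.down ∧ L = []
  | .wire a, V, L, _ => ∃ l, V = .lab l ∧ L = [(l, a)]
  | .tensor A B, V, L, p => ∃ V₁ V₂ L₁ L₂, V = .pair V₁ V₂ ∧ L = L₁ ++ L₂ ∧
      A.Rel V₁ L₁ p.1 ∧ B.Rel V₂ L₂ p.2
  | .bang A, V, L, f => ∃ M, V = .lift M ∧ L = [] ∧ M.LC 0 ∧
      Run (fun X L' => A.Rel X L' (f PUnit.unit).1) M [] (f PUnit.unit).2
  | .circ T U, V, L, f => ∃ (l k : Bundle) (Q K Q' K' : LCtx W) (C : Circ ι Q K) (σ : LPerm Q' Q)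
      (τ : LPerm K K') (h : T.wires = Q'.wires) (h' : K'.wires = U.wires),
      V = .boxed l C k ∧ L = [] ∧ (List.map Prod.fst Q').Nodup ∧ (List.map Prod.fst K').Nodup ∧
      T.Rel l Q' ∧ U.Rel k K' ∧ f = same ι h ≫ σ.perm ι ≫ C ≫ τ.perm ι ≫ same ι h'
  | .arrow A B T, V, L, f => ∃ M, V = .lam A M ∧ L.wires = T ∧ M.LC 1 ∧
      ∀ X L' a, A.Rel X L' a →
        Run (fun Y L'' => B.Rel Y L'' (f a).1) (M.opn X 0) (L ++ L') (f a).2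

theorem Ty.Rel.wires_eq : ∀ {A : Ty W} {V : Val ι} {L : LCtx W} {a : A.val ι}, A.Rel V L a →
    LCtx.wires L = A.wires
  | .unit, _, _, _, ⟨_, h⟩ => by subst h; rfl
  | .nat, _, _, _, ⟨_, h⟩ => by subst h; rfl
  | .wire _, _, _, _, ⟨_, _, h⟩ => by subst h; rfl
  | .tensor _ _, _, _, _, ⟨_, _, _, _, _, h, h₁, h₂⟩ => by
    subst h
    rw [LCtx.wires_append, h₁.wires_eq, h₂.wires_eq]; rfl
  | .bang _, _, _, _, ⟨_, _, h, _⟩ => by subst h; rfl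
  | .circ _ _, _, _, _, ⟨_, _, _, _, _, _, _, _, _, _, _, _, h, _⟩ => by subst h; rfl
  | .arrow _ _ _, _, _, _, ⟨_, _, h, _⟩ => h

theorem LCtx.eq_nil_of_wires {L : LCtx W} (h : L.wires = []) : L = [] := by
  simpa [LCtx.wires] using h

theorem Ty.Rel.LC : ∀ {A : Ty W} {V : Val ι} {L : LCtx W} {a : A.val ι}, A.Rel V L a → V.LC 0
  | .unit, _, _, _, ⟨h, _⟩ => by subst h; trivial
  | .nat, _, _, _, ⟨h, _⟩ => by subst h; trivial
  | .wire _, _, _, _, ⟨_, h, _⟩ => by subst h; trivial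
  | .tensor _ _, _, _, _, ⟨_, _, _, _, h, _, h₁, h₂⟩ => by
    subst h
    exact ⟨h₁.LC, h₂.LC⟩
  | .bang _, _, _, _, ⟨_, h, _, hM, _⟩ => by subst h; exact hM
  | .circ _ _, _, _, _, ⟨_, _, _, _, _, _, _, _, _, _, _, h, _⟩ => by subst h; trivial
  | .arrow _ _ _, _, _, _, ⟨_, h, _, hM, _⟩ => by subst h; exact hM

/-- At bundle types the relation does not depend on the (unique) semantic element. -/
theorem BTy.rel_toTy : ∀ {T : BTy W} {V : Val ι} {L : LCtx W} {a : T.toTy.val ι},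
    T.toTy.Rel V L a ↔ ∃ b : Bundle, V = b.toVal ∧ T.Rel b L
  | .unit, _, _, _ =>
    ⟨fun ⟨h, h'⟩ => ⟨.unit, h, rfl, h'⟩, fun ⟨_, hV, hb, h'⟩ => ⟨by rw [hV, hb]; rfl, h'⟩⟩
  | .wire _, _, _, _ =>
    ⟨fun ⟨l, h, h'⟩ => ⟨.lab l, h, l, rfl, h'⟩,
      fun ⟨_, hV, l, hb, h'⟩ => ⟨l, by rw [hV, hb]; rfl, h'⟩⟩
  | .tensor T U, V, L, a => by
    constructor
    · rintro ⟨V₁, V₂, L₁, L₂, rfl, rfl, h₁, h₂⟩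
      obtain ⟨b₁, rfl, hb₁⟩ := BTy.rel_toTy.mp h₁
      obtain ⟨b₂, rfl, hb₂⟩ := BTy.rel_toTy.mp h₂
      exact ⟨.pair b₁ b₂, rfl, _, _, _, _, rfl, rfl, hb₁, hb₂⟩
    · rintro ⟨_, rfl, b₁, b₂, L₁, L₂, rfl, rfl, h₁, h₂⟩
      exact ⟨b₁.toVal, b₂.toVal, L₁, L₂, rfl, rfl, BTy.rel_toTy.mpr ⟨_, rfl, h₁⟩,
        BTy.rel_toTy.mpr ⟨_, rfl, h₂⟩⟩

variable {P P' : Val ι → LCtx W → Prop} {M N : Comp ι} {V X : Val ι} {L L' : LCtx W}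
  {S T U : List W}

theorem Run.expand {c : obs ι T ⟶ obs ι U} (h : Run P M L c)
    (hMN : ∀ ⦃Q K K' : LCtx W⦄ ⦃C : Circ ι Q K⦄ ⦃D : Circ ι Q K'⦄ ⦃X : Val ι⦄,
      Eval C M D X → Eval C N D X) : Run P N L c := by
  intro Q K C R σ hn
  obtain ⟨K', D, X, L', σ', hn', hD, h'⟩ := h C R σ hn
  exact ⟨K', D, X, L', σ', hn', hMN hD, h'⟩

theorem Run.lperm {c : obs ι T ⟶ obs ι U} (h : Run P M L' c) (p : LPerm L L')
    {e : obs ι S ⟶ obs ι T} (hS : S = L.wires) (hT : L'.wires = T)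
    (he : e = same ι hS ≫ p.perm ι ≫ same ι hT) : Run P M L (e ≫ c) := by
  intro Q K C R σ hn
  obtain ⟨K', D, X, L'', σ', hn', hD, hP, h₁, h₂, heq⟩ := h C R (σ.trans (p.appR R))
    (((p.appR R).toPerm.map _).nodup_iff.mp hn)
  refine ⟨K', D, X, L'', σ', hn', hD, hP, by rw [LCtx.wires_append, hS], h₂, ?_⟩
  rw [heq, LPerm.perm, LPerm.perm_appR, he]
  simp only [padR_comp, padR_same, Category.assoc, same_comp_same_assoc]

theorem Run.same_comp {c : obs ι T ⟶ obs ι U} (h : Run P M L c) (hL : LCtx.wires L = T)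
    (hS : S = T) : Run P M L (same ι hS ≫ c) :=
  h.lperm (.refl L) (hS.trans hL.symm) hL
    (by rw [LPerm.perm_refl, Category.id_comp, same_comp_same])

theorem Run.ret (hV : P V L) (hL : LCtx.wires L = T) (h : T = U) :
    Run P (.ret V) L (same ι h) := by
  intro Q K C R σ hn
  refine ⟨K, C, V, L, σ, hn, .ret, hV, by rw [LCtx.wires_append, hL],
    by rw [LCtx.wires_append, hL, h], ?_⟩
  rw [padR_same, same_comp_same, same_comp_same, same_rfl, Category.comp_id]

theorem Run.letin {L₁ L₂ : LCtx W} {T₁ T₂ U₁ S₁ : List W} {c₁ : obs ι T₁ ⟶ obs ι U₁}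
    {c₂ : obs ι S ⟶ obs ι U} (h₁ : Run P' M L₁ c₁)
    (h₂ : ∀ X L', P' X L' → Run P (N.opn X 0) (L₂ ++ L') c₂)
    (hL₁ : LCtx.wires L₁ = T₁) (hL₂ : LCtx.wires L₂ = T₂)
    (hS₁ : S₁ = T₂ ++ T₁) (hS₂ : T₂ ++ U₁ = S) :
    Run P (.letin M N) (L₂ ++ L₁) (same ι hS₁ ≫ padL T₂ c₁ ≫ same ι hS₂ ≫ c₂) := by
  intro Q K C R σ hn
  let p₁ : LPerm (L₂ ++ L₁ ++ R) (L₁ ++ (L₂ ++ R)) :=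
    ((LPerm.blocks L₂ L₁).appR R).trans (.ofEq (List.append_assoc ..))
  obtain ⟨K₁, D₁, X, L', σ₁, hn₁, hD₁, hX, e₁, e₁', heq₁⟩ :=
    h₁ C (L₂ ++ R) (σ.trans p₁) ((p₁.toPerm.map _).nodup_iff.mp hn)
  let p₂ : LPerm (L' ++ (L₂ ++ R)) (L₂ ++ L' ++ R) :=
    (LPerm.ofEq (List.append_assoc ..).symm).trans ((LPerm.blocks L' L₂).appR R)
  obtain ⟨K₂, D₂, Y, L'', σ₂, hn₂, hD₂, hY, e₂, e₂', heq₂⟩ :=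
    h₂ X L' hX D₁ R (σ₁.trans p₂) ((p₂.toPerm.map _).nodup_iff.mp hn₁)
  refine ⟨K₂, D₂, Y, L'', σ₂, hn₂, .letin hD₁ hD₂, hY, ?_, e₂', ?_⟩
  · rw [LCtx.wires_append, LCtx.wires_append, hL₁, hL₂, hS₁]
  have hU₁ : U₁ = LCtx.wires L' := by
    exact List.append_cancel_right (e₁'.trans (LCtx.wires_append ..))
  subst hU₁ hL₁ hL₂
  have key : swapBlocks ι L₂.wires L₁.wires ≫ padR c₁ L₂.wires ≫
      swapBlocks ι L'.wires L₂.wires = padL L₂.wires c₁ := by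
    rw [padR_swapBlocks, ← Category.assoc, swapBlocks_swapBlocks, Category.id_comp]
  rw [heq₂, LPerm.perm, Category.assoc, reassoc_of% heq₁, ← key]
  simp only [p₁, p₂, LPerm.perm, LPerm.perm_appR, LPerm.perm_ofEq, LPerm.perm_blocks, padR_comp,
    padR_same, padR_padR]
  rw [padR_congr c₁ (LCtx.wires_append L₂ R)]
  simp only [Category.assoc, same_comp_same, same_comp_same_assoc]

theorem Run.box {B : BTy W} {B' : BTy W} {f : (Ty.arrow B.toTy B'.toTy []).val ι}
    (hV : (Ty.arrow B.toTy B'.toTy []).Rel V L f) (hT : T = []) :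
    Run (fun X L' => (Ty.circ B B').Rel X L' (f (B.pt ι)).2) (.box B V) L (same ι hT) := by
  obtain ⟨M, rfl, hL, -, hM⟩ := hV
  obtain rfl := LCtx.eq_nil_of_wires hL
  intro Q K C R σ hn
  obtain ⟨b, Q₁, n, -, hb, hQ₁, hfresh⟩ :=
    B.exists_rel ((Val.lam B.toTy M : Val ι).labels.sup id + 1)
  obtain ⟨K', D, X, L', σ', hn', hD, hX, e, e', heq⟩ :=
    hM b.toVal Q₁ (B.pt ι) (BTy.rel_toTy.mpr ⟨b, rfl, hb⟩) (𝟙 _ : Circ ι Q₁ Q₁) []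
      (.ofEq (by simp)) (by simpa using hQ₁)
  obtain ⟨k, rfl, hk⟩ := BTy.rel_toTy.mp hX
  obtain ⟨dl⟩ := hb.typing (ι := ι) hQ₁
  refine ⟨K, C, .boxed b D k, [], σ, hn, .box dl (fun p hp hmem => ?_) (.app hD), ?_,
    by rw [hT]; rfl, rfl, ?_⟩
  · have h₁ := (hfresh p hp).1
    exact (Nat.lt_of_succ_le h₁).not_ge (Finset.le_sup (f := id) hmem)
  · refine ⟨b, k, Q₁, K', Q₁, L', D, .refl _, σ'.trans (.ofEq (by simp)), hb.wires_eq.symm,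
      hk.wires_eq, rfl, rfl, hQ₁, by simpa using hn', hb, hk, ?_⟩
    rw [LPerm.perm, Category.assoc, reassoc_of% heq, LPerm.perm_ofEq, LPerm.perm_ofEq,
      LPerm.perm_refl]
    have hp : padR (f (B.pt ι)).2 (LCtx.wires ([] : LCtx W)) = _ := padR_nil (f (B.pt ι)).2
    rw [hp]
    simp only [Category.id_comp, Category.assoc, same_comp_same, same_comp_same_assoc, same_rfl]
    exact (Category.comp_id _).symm
  · rw [padR_same, same_comp_same, same_comp_same, same_rfl, Category.comp_id]

theorem Run.apply {B B' : BTy W} {f : (Ty.circ B B').val ι} {a : B.toTy.val ι}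
    {a' : B'.toTy.val ι} {L₁ L₂ : LCtx W} (hV : (Ty.circ B B').Rel V L₁ f)
    (hX : B.toTy.Rel X L₂ a) :
    Run (fun Y L' => B'.toTy.Rel Y L' a') (.apply V X) (L₁ ++ L₂)
      (T := B.wires) (U := B'.wires) f := by
  obtain ⟨l, k, Q, K, Q', K', E, τ, τ', h, h', rfl, rfl, hQ', hK', hl, hk, rfl⟩ := hV
  obtain ⟨b, rfl, hb⟩ := BTy.rel_toTy.mp hX
  obtain ⟨ρ, rfl⟩ := LCtx.exists_rename hQ' (hl.wires_eq.trans hb.wires_eq.symm)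
  obtain rfl := hb.unique (hl.rename ρ)
  intro Q₀ K₀ C R σ hn
  have hR : (List.map Prod.fst R).Nodup := by
    rw [List.map_append] at hn
    exact hn.of_append_right
  obtain ⟨ρ', hρ'⟩ := LCtx.exists_nodup_rename hK' R hR
  let p : LPerm (K.rename ρ' ++ R) (K'.rename ρ' ++ R) := (τ'.rename ρ').appR R
  refine ⟨_, _, _, _, p, hρ', .apply E ρ ρ' (LPerm.trans σ ((τ.rename ρ).appR R))
    ((p.toPerm.map _).nodup_iff.mpr hρ'), BTy.rel_toTy.mpr ⟨_, rfl, hk.rename ρ'⟩, ?_, ?_, ?_⟩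
  · rw [List.nil_append, LCtx.wires_append, hb.wires_eq]
  · rw [LCtx.wires_append, (hk.rename ρ').wires_eq]
  · simp only [append, p, LPerm.perm, LPerm.perm_appR, LPerm.perm_rename, padR_comp, padR_same,
      Category.assoc, same_comp_same, same_comp_same_assoc, same_rfl, Category.id_comp]

end LogicalRelation

/-! ### Environments -/

section Fundamental

variable {W : Type w} {𝓜 : Type u} [StrictSymmPremonoidal.{v} 𝓜] {ι : W → 𝓜}

theorem Bundle.toVal_injective : ∀ {b b' : Bundle}, (b.toVal : Val ι) = b'.toVal → b = b'
  | .unit, .unit, _ => rfl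
  | .lab _, .lab _, h => by simpa [Bundle.toVal] using h
  | .pair _ _, .pair _ _, h => by
    simp only [Bundle.toVal, Val.pair.injEq] at h
    rw [Bundle.toVal_injective h.1, Bundle.toVal_injective h.2]
  | .unit, .lab _, h => by simp [Bundle.toVal] at h
  | .unit, .pair _ _, h => by simp [Bundle.toVal] at h
  | .lab _, .unit, h => by simp [Bundle.toVal] at h
  | .lab _, .pair _ _, h => by simp [Bundle.toVal] at h
  | .pair _ _, .unit, h => by simp [Bundle.toVal] at h
  | .pair _ _, .lab _, h => by simp [Bundle.toVal] at h

/-- The value substituted for an entry. -/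
def Entry.inst (γ : ℕ → Val ι) : Entry W → Val ι
  | .var x _ => γ x
  | .lab l _ => .lab l

/-- The values substituted for the entries of `Γ`, which jointly own the labels `L`, realize an
element of `♭⟦Γ⟧`. -/
def Ctx.Rel (γ : ℕ → Val ι) : (Γ : Ctx W) → LCtx W → Ctx.val ι Γ → Prop
  | [], L, _ => L = []
  | e :: Γ, L, g => ∃ L₁ L₂, L = L₁ ++ L₂ ∧ e.ty.Rel (e.inst γ) L₁ g.1 ∧ Ctx.Rel γ Γ L₂ g.2

theorem Ctx.Rel.wires_eq {γ : ℕ → Val ι} : ∀ {Γ : Ctx W} {L : LCtx W} {g : Ctx.val ι Γ},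
    Ctx.Rel γ Γ L g → L.wires = Γ.wires
  | [], _, _, h => by cases h; rfl
  | e :: Γ, _, _, ⟨_, _, h, h₁, h₂⟩ => by
    subst h
    rw [LCtx.wires_append, h₁.wires_eq, h₂.wires_eq]; rfl

theorem Ctx.Rel.eq_nil {γ : ℕ → Val ι} {Φ : Ctx W} {L : LCtx W} {g : Ctx.val ι Φ}
    (h : Ctx.Rel γ Φ L g) (hΦ : Φ.IsParam) : L = [] :=
  LCtx.eq_nil_of_wires (h.wires_eq.trans hΦ.wires_eq_nil)

theorem Ctx.Rel.split {γ : ℕ → Val ι} : ∀ {Γ Δ : Ctx W} {L : LCtx W} {g : Ctx.val ι (Γ ++ Δ)},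
    Ctx.Rel γ (Γ ++ Δ) L g → ∃ L₁ L₂, L = L₁ ++ L₂ ∧ Ctx.Rel γ Γ L₁ (Ctx.split Γ g).1 ∧
      Ctx.Rel γ Δ L₂ (Ctx.split Γ g).2
  | [], _, L, _, h => ⟨[], L, rfl, rfl, h⟩
  | e :: Γ, Δ, _, g, ⟨L₁, L₂, hL, h₁, h₂⟩ => by
    obtain ⟨L₃, L₄, rfl, h₃, h₄⟩ := Ctx.Rel.split (Γ := Γ) (Δ := Δ) h₂
    exact ⟨L₁ ++ L₃, L₄, by rw [hL, List.append_assoc], ⟨L₁, L₃, rfl, h₁, h₃⟩, h₄⟩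

theorem Ctx.Rel.join {γ : ℕ → Val ι} : ∀ {Γ Δ : Ctx W} {L₁ L₂ : LCtx W} {g : Ctx.val ι Γ}
    {d : Ctx.val ι Δ}, Ctx.Rel γ Γ L₁ g → Ctx.Rel γ Δ L₂ d →
      Ctx.Rel γ (Γ ++ Δ) (L₁ ++ L₂) (Ctx.join g d)
  | [], _, _, _, _, _, h₁, h₂ => by cases h₁; exact h₂
  | e :: Γ, Δ, _, L₄, _, _, ⟨L₁, L₂, hL, h₁, h₂⟩, h₃ =>
    ⟨L₁, L₂ ++ L₄, by rw [hL, List.append_assoc], h₁, h₂.join h₃⟩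

theorem Ctx.Rel.dup {γ : ℕ → Val ι} {Φ Γ₁ Γ₂ : Ctx W} {L : LCtx W}
    {g : Ctx.val ι (Φ ++ Γ₁ ++ Γ₂)} (hΦ : Φ.IsParam) (h : Ctx.Rel γ (Φ ++ Γ₁ ++ Γ₂) L g) :
    ∃ L₁ L₂, L = L₁ ++ L₂ ∧ Ctx.Rel γ (Φ ++ Γ₁) L₁ (Ctx.dup Φ Γ₁ Γ₂ g).1 ∧
      Ctx.Rel γ (Φ ++ Γ₂) L₂ (Ctx.dup Φ Γ₁ Γ₂ g).2 := by
  obtain ⟨L₁, L₂, hL, h₁, h₂⟩ := h.split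
  obtain ⟨L₃, L₄, -, h₃, -⟩ := h₁.split
  obtain rfl := h₃.eq_nil hΦ
  exact ⟨L₁, L₂, hL, h₁, h₃.join h₂⟩

theorem Ctx.rel_single {γ : ℕ → Val ι} {x : ℕ} {A : Ty W} {L : LCtx W} {a : A.val ι} {X : Val ι}
    (hX : γ x = X) (h : A.Rel X L a) : Ctx.Rel γ [.var x A] L (a, PUnit.unit) := by
  subst hX
  exact ⟨L, [], (List.append_nil L).symm, h, rfl⟩

theorem Ctx.rel_pair {γ : ℕ → Val ι} {x y : ℕ} {A B : Ty W} {L L' : LCtx W} {a : A.val ι}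
    {b : B.val ι} {X Y : Val ι} (hx : γ x = X) (hy : γ y = Y) (h : A.Rel X L a)
    (h' : B.Rel Y L' b) : Ctx.Rel γ [.var x A, .var y B] (L ++ L') (a, b, PUnit.unit) := by
  subst hx
  exact ⟨L, L', rfl, h, Ctx.rel_single hy h'⟩

theorem Ctx.Rel.congr {γ γ' : ℕ → Val ι} : ∀ {Γ : Ctx W} {L : LCtx W} {g : Ctx.val ι Γ},
    Ctx.Rel γ Γ L g → (∀ x, Sum.inl x ∈ List.map Entry.name Γ → γ x = γ' x) → Ctx.Rel γ' Γ L g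
  | [], _, _, h, _ => h
  | .var x A :: Γ, _, _, ⟨L₁, L₂, hL, h₁, h₂⟩, h =>
    ⟨L₁, L₂, hL, by
      show A.Rel (γ' x) L₁ _
      rw [← h x (by simp [Entry.name])]
      exact h₁,
      h₂.congr fun y hy => h y (List.mem_cons_of_mem _ hy)⟩
  | .lab l a :: Γ, _, _, ⟨L₁, L₂, hL, h₁, h₂⟩, h =>
    ⟨L₁, L₂, hL, h₁, h₂.congr fun y hy => h y (List.mem_cons_of_mem _ hy)⟩

theorem Ctx.Rel.update {γ : ℕ → Val ι} {Γ Δ : Ctx W} {L : LCtx W} {g : Ctx.val ι Γ} {x : ℕ}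
    {A : Ty W} {X : Val ι} (h : Ctx.Rel γ Γ L g) (hwf : Ctx.WF (Γ ++ .var x A :: Δ)) :
    Ctx.Rel (Function.update γ x X) Γ L g := by
  refine h.congr fun y hy => ?_
  rw [Function.update_of_ne]
  rintro rfl
  unfold Ctx.WF at hwf
  rw [List.map_append, List.nodup_append] at hwf
  exact hwf.2.2 _ hy _ (by simp [Entry.name]) rfl

theorem update_LC {γ : ℕ → Val ι} (hγ : ∀ x, (γ x).LC 0) {X : Val ι} (hX : X.LC 0) (x y : ℕ) :
    (Function.update γ x X y).LC 0 := by
  rcases eq_or_ne y x with rfl | hy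
  · simpa using hX
  · simpa [hy] using hγ y

/-- The labels of a label context realize its unique semantic element. -/
theorem LCtx.rel_pt (γ : ℕ → Val ι) : ∀ Q : LCtx W, Ctx.Rel γ Q.toCtx Q (LCtx.pt Q)
  | [] => rfl
  | p :: Q => ⟨[p], Q, rfl, ⟨p.1, rfl, rfl⟩, LCtx.rel_pt γ Q⟩

/-! ### The fundamental lemma -/

theorem Run.exch {γ : ℕ → Val ι} {P : Val ι → LCtx W → Prop} {M : Comp ι} {Γ₁ Γ₂ : Ctx W}
    {a b : Entry W} {U : List W} {L : LCtx W} {g : Ctx.val ι (Γ₁ ++ [b] ++ [a] ++ Γ₂)}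
    (h : Ctx.Rel γ (Γ₁ ++ [b] ++ [a] ++ Γ₂) L g)
    {c : obs ι (Ctx.wires (Γ₁ ++ [a] ++ [b] ++ Γ₂)) ⟶ obs ι U}
    (hM : ∀ L', Ctx.Rel γ (Γ₁ ++ [a] ++ [b] ++ Γ₂) L' (Ctx.exch Γ₁ Γ₂ a b g) → Run P M L' c) :
    Run P M L (Ctx.exchPerm ι Γ₁ Γ₂ a b ≫ c) := by
  have hL := h.wires_eq
  obtain ⟨_, L₂, rfl, h', h₂⟩ := h.split
  obtain ⟨_, La, rfl, h', ha⟩ := h'.split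
  obtain ⟨L₁, Lb, rfl, h₁, hb⟩ := h'.split
  have hrel := ((h₁.join ha).join hb).join h₂
  refine (hM _ hrel).lperm (LPerm.trans (LPerm.ofEq (by simp)) (LPerm.trans
    (.appL L₁ ((LPerm.blocks Lb La).appR L₂)) (.ofEq (by simp)))) hL.symm hrel.wires_eq ?_
  have e₁ := h₁.wires_eq
  have e₂ := h₂.wires_eq
  have ea := ha.wires_eq
  have eb := hb.wires_eq
  rw [Ctx.wires_single] at ea eb
  unfold Ctx.exchPerm
  simp only [LPerm.perm, LPerm.perm_appR, LPerm.perm_appL, LPerm.perm_ofEq, LPerm.perm_blocks,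
    padL_comp, padL_same, padR_comp, padR_same, Category.assoc, same_comp_same,
    same_comp_same_assoc]
  rw [swapBlocks_congr eb ea, padR_congr _ e₂, padL_congr _ e₁]
  simp only [padL_comp, padL_same, padR_comp, padR_same, Category.assoc, same_comp_same,
    same_comp_same_assoc]

mutual

theorem VTy.fundamental {γ : ℕ → Val ι} (hγ : ∀ x, (γ x).LC 0) : ∀ {Γ : Ctx W} {V : Val ι}
    {A : Ty W} (d : VTy Γ V A) {L : LCtx W} {g : Ctx.val ι Γ}, Ctx.Rel γ Γ L g →
      A.Rel (V.subst γ) L (d.sem g)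
  | _, _, _, .unit hΦ _, _, _, h => ⟨rfl, h.eq_nil hΦ⟩
  | _, _, _, .nat hΦ _ _, _, _, h => by
    rw [VTy.sem]
    exact ⟨rfl, h.eq_nil hΦ⟩
  | _, _, _, .lab hΦ l a _, _, _, h => by
    obtain ⟨L₁, L₂, rfl, h₁, L₃, L₄, rfl, h₂, h₃⟩ := h.split
    obtain rfl := h₁.eq_nil hΦ
    cases h₃
    rw [VTy.sem, List.nil_append, List.append_nil]
    exact h₂
  | _, _, _, .var hΦ x A _, _, _, h => by
    obtain ⟨L₁, L₂, rfl, h₁, L₃, L₄, rfl, h₂, h₃⟩ := h.split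
    obtain rfl := h₁.eq_nil hΦ
    cases h₃
    rw [VTy.sem, List.nil_append, List.append_nil]
    exact h₂
  | _, _, _, .abs (Γ := Γ) (A := A) (M := M) x hx d, L, g, h => by
    rw [VTy.sem]
    refine ⟨M.subst γ, rfl, h.wires_eq,
      Comp.LC.subst hγ M 1 (Comp.LC_of_opn M 0 0 le_rfl d.LC), fun X L' a hX => ?_⟩
    rw [← Comp.subst_update_opn hγ hX.LC hx]
    have hrel : Ctx.Rel (Function.update γ x X) (Γ ++ [.var x A]) (L ++ L')
        (Ctx.join g (show Ctx.val ι [.var x A] from (a, PUnit.unit))) :=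
      (h.update d.wf).join (Ctx.rel_single (Function.update_self ..) hX)
    exact (CTy.fundamental (update_LC hγ hX.LC x) d hrel).same_comp hrel.wires_eq _
  | _, _, _, .lift hΦ d, _, _, h => by
    rw [VTy.sem]
    obtain rfl := h.eq_nil hΦ
    exact ⟨_, rfl, rfl, Comp.LC.subst hγ _ 0 d.LC,
      (CTy.fundamental hγ d h).same_comp h.wires_eq _⟩
  | _, _, _, .circ hΦ hn C σ τ dl dk, _, _, h => by
    rw [VTy.sem]
    obtain ⟨l, hl, hl'⟩ := BTy.rel_toTy.mp (VTy.fundamental hγ dl (LCtx.rel_pt γ _))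
    obtain ⟨k, hk, hk'⟩ := BTy.rel_toTy.mp (VTy.fundamental hγ dk (LCtx.rel_pt γ _))
    rw [Bundle.subst_toVal] at hl hk
    obtain rfl := Bundle.toVal_injective hl
    obtain rfl := Bundle.toVal_injective hk
    exact ⟨_, _, _, _, _, _, C, σ, τ, _, _, rfl, h.eq_nil hΦ, LCtx.toCtx_wf.mp dl.wf,
      LCtx.toCtx_wf.mp dk.wf, hl', hk', rfl⟩
  | _, _, _, .pair hΦ _ d₁ d₂, _, _, h => by
    rw [VTy.sem]
    obtain ⟨L₁, L₂, rfl, h₁, h₂⟩ := h.dup hΦ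
    exact ⟨_, _, L₁, L₂, rfl, rfl, VTy.fundamental hγ d₁ h₁, VTy.fundamental hγ d₂ h₂⟩

theorem CTy.fundamental {γ : ℕ → Val ι} (hγ : ∀ x, (γ x).LC 0) : ∀ {Γ : Ctx W} {M : Comp ι}
    {A : Ty W} (d : CTy Γ M A) {L : LCtx W} {g : Ctx.val ι Γ}, Ctx.Rel γ Γ L g →
      Run (fun V L' => A.Rel V L' (d.sem g).1) (M.subst γ) L (d.sem g).2
  | _, _, _, .app hΦ _ d₁ d₂, _, _, h => by
    have hL := h.wires_eq
    rw [CTy.sem]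
    obtain ⟨L₁, L₂, rfl, h₁, h₂⟩ := h.dup hΦ
    obtain ⟨M, hV, hT, -, hM⟩ := VTy.fundamental hγ d₁ h₁
    have hX := VTy.fundamental hγ d₂ h₂
    rw [Comp.subst, hV]
    refine ((hM _ L₂ _ hX).expand fun _ _ _ _ _ _ => .app).same_comp ?_ _
    rw [LCtx.wires_append, hT, hX.wires_eq]
  | _, _, _, .force hΦ d, _, _, h => by
    rw [CTy.sem]
    obtain rfl := h.eq_nil hΦ
    obtain ⟨M, hV, -, -, hM⟩ := VTy.fundamental hγ d h
    rw [Comp.subst, hV]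
    exact (hM.expand fun _ _ _ _ _ _ => .force).same_comp rfl _
  | _, _, _, .box hΦ d, _, _, h => by
    rw [CTy.sem]
    exact Run.box (VTy.fundamental hγ d h) hΦ.wires_eq_nil
  | _, _, _, .apply hΦ _ d₁ d₂, _, _, h => by
    rw [CTy.sem]
    obtain ⟨L₁, L₂, rfl, h₁, h₂⟩ := h.dup hΦ
    have hV := VTy.fundamental hγ d₁ h₁
    have hX := VTy.fundamental hγ d₂ h₂
    refine (Run.apply hV hX).same_comp ?_ _
    rw [LCtx.wires_append, hV.wires_eq, hX.wires_eq]; rfl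
  | _, _, _, .dest (Γ₁ := Γ₁) (Γ₂ := Γ₂) (A := A) (B := B) hΦ _ x y hx hy d₁ d₂, _, _, h => by
    rw [CTy.sem]
    obtain ⟨L₂, L₁, rfl, h₂, h₁⟩ := h.dup hΦ
    obtain ⟨X, Y, La, Lb, hV, rfl, hX, hY⟩ := VTy.fundamental hγ d₁ h₁
    rw [Comp.subst, hV]
    have hwf := d₂.wf
    have hxy : x ≠ y := by
      rintro rfl
      unfold Ctx.WF at hwf
      rw [List.map_append, List.nodup_append] at hwf
      simpa [Entry.name] using hwf.2.1
    have hrel := ((h₂.update (X := X) hwf).update (X := Y) (Δ := [.var x A])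
      (by
        unfold Ctx.WF at hwf ⊢
        refine (List.Perm.nodup_iff (List.Perm.map _ ?_)).mp hwf
        exact List.Perm.append_left _ (List.Perm.swap _ _ _))).join
      (Ctx.rel_pair (by rw [Function.update_of_ne hxy, Function.update_self])
        (Function.update_self ..) hX hY)
    refine Run.same_comp ?_ hrel.wires_eq _
    refine Run.expand ?_ fun _ _ _ _ _ _ => .dest
    rw [← Comp.subst_update_opn₂ hγ hxy hX.LC hY.LC hx hy]
    exact CTy.fundamental (update_LC (update_LC hγ hX.LC x) hY.LC y) d₂ hrel
  | _, _, _, .ifz hΦ d d₁ d₂, _, _, h => by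
    obtain ⟨L₁, L₂, -, h₁, -⟩ := h.split
    have hV := (VTy.fundamental hγ d h₁).1
    rw [CTy.sem, Comp.subst, hV]
    cases (d.sem (Ctx.split _ _).1).down with
    | zero => exact (CTy.fundamental hγ d₁ h).expand fun _ _ _ _ _ _ => .ifzZero
    | succ n => exact (CTy.fundamental hγ d₂ h).expand fun _ _ _ _ _ _ => .ifzSucc n
  | _, _, _, .ret d, _, _, h => by
    rw [CTy.sem]
    exact Run.ret (VTy.fundamental hγ d h) h.wires_eq d.wires_eq
  | _, _, _, .letin hΦ _ x hx d₁ d₂, _, _, h => by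
    rw [CTy.sem]
    obtain ⟨L₂, L₁, rfl, h₂, h₁⟩ := h.dup hΦ
    refine Run.letin (CTy.fundamental hγ d₁ h₁) (fun X L' hX => ?_) h₁.wires_eq ?_ _ _
    · rw [← Comp.subst_update_opn hγ hX.LC hx]
      exact CTy.fundamental (update_LC hγ hX.LC x) d₂
        ((h₂.update d₂.wf).join (Ctx.rel_single (Function.update_self ..) hX))
    · rw [h₂.wires_eq, Ctx.wires_append, hΦ.wires_eq_nil, List.nil_append]
  | _, _, _, .ex d, _, _, h => by
    rw [CTy.sem]
    exact Run.exch h fun L' hL' => CTy.fundamental hγ d hL'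

end

end Fundamental

end PQC

/-- Computational adequacy for Proto-Quipper-C. -/
theorem mainTheorem2 {W : Type w} {𝓜 : Type u} [PQC.StrictSymmPremonoidal.{v} 𝓜] (ι : W → 𝓜)
    {K K' : PQC.LCtx W} (C : PQC.Circ ι [] K) (M : PQC.Comp ι)
    (D : PQC.Circ ι [] K') (V : PQC.Val ι)
    (hM : PQC.CompConfig C M PQC.Ty.unit []) (hV : PQC.ValConfig D V PQC.Ty.unit [])
    (h : hM.sem = PQC.J hV.sem) :
    PQC.Eval C M D V := by
  have hγ : ∀ x, (PQC.Val.fvar x : PQC.Val ι).LC 0 := fun _ => trivial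
  revert h
  obtain ⟨-, L, σ, -, d⟩ := hV
  obtain ⟨-, L₁, τ, hn, e⟩ := hM
  intro h
  obtain ⟨hV₁, rfl⟩ := PQC.VTy.fundamental hγ d (PQC.LCtx.rel_pt _ L)
  rw [PQC.Val.subst_fvar] at hV₁
  subst hV₁
  obtain ⟨K₁, D₁, X, L', σ₁, -, hD, ⟨rfl, rfl⟩, h₁, h₂, heq⟩ :=
    PQC.CTy.fundamental hγ e (PQC.LCtx.rel_pt _ L₁) C [] τ hn
  rw [PQC.Comp.subst_fvar] at hD
  obtain rfl : K₁ = [] := σ₁.eq_nil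
  obtain rfl : K' = [] := σ.eq_nil
  have hs := congrArg Prod.snd (congrFun h PUnit.unit)
  simp only [PQC.CompConfig.sem, PQC.ValConfig.sem, PQC.J, PQC.KHom.comp, Category.assoc] at hs
  rw [PQC.LPerm.perm_eq_same ι σ rfl rfl] at hs
  rw [PQC.LPerm.perm_eq_same ι σ₁ rfl rfl] at heq
  suffices hDD : D₁ = D by
    rw [← hDD]
    exact hD
  calc D₁ = D₁ ≫ PQC.same ι rfl := (Category.comp_id _).symm
    _ = _ := heq
    _ = (C ≫ τ.perm ι ≫ PQC.same ι h₁ ≫ PQC.padR (e.sem (PQC.LCtx.pt L₁)).2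
          (PQC.LCtx.wires [])) ≫ PQC.same ι h₂ := by simp only [Category.assoc]
    _ = _ ≫ PQC.same ι h₂ := congrArg (· ≫ PQC.same ι h₂) hs
    _ = D := by
      change (D ≫ 𝟙 (PQC.obs ι []) ≫ 𝟙 (PQC.obs ι [])) ≫ 𝟙 (PQC.obs ι []) = D
      rw [Category.comp_id, Category.comp_id]
      exact Category.comp_id _
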